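/- Let $N\ge 1$ be an integer, let $B_r\subset\mathbb{R}^N$ denote the open ball of radius $r$ centred at $0$, and let $p\in[2,\infty)$ and $q\in[1,\infty)$ satisfy $q>\frac{p-2}{2}N$. Then for every $\eta>0$ and all $0<\rho<R$ there exists $\delta>0$ (depending only on $N,p,q,\eta,\rho,R$) such that the following holds. If $w\in L^{p-1}(B_R)$ satisfies $w\ge 0$ almost everywhere in $B_R$, $-\Delta w\le w^{p-1}$ in the sense of distributions in $B_R$, that is, \[ -\int_{B_R} w\,\Delta\varphi \le \int_{B_R} w^{p-1}\varphi \qquad\text{for every } \varphi\in C_c^\infty(B_R) \text{ with } \varphi\ge 0, \] and $\int_{B_R} w^q\le\delta$, then $\|w\|_{L^\infty(B_\rho)}\le\eta$. -/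

import Mathlib

open MeasureTheory Metric
open scoped ENNReal ContDiff Laplacian

/-- `-Δ w ≤ f` in the sense of distributions in `Ω`: the functions `w` and `f` are locally
integrable in `Ω`, and `-∫_Ω w Δφ ≤ ∫_Ω f φ` for every nonnegative smooth function `φ` with compact
support contained in `Ω`. -/
def NegLaplacianLeDistrib {N : ℕ} (Ω : Set (EuclideanSpace ℝ (Fin N)))
    (w f : EuclideanSpace ℝ (Fin N) → ℝ) : Prop :=
  LocallyIntegrableOn w Ω volume ∧ LocallyIntegrableOn f Ω volume ∧
    ∀ φ : EuclideanSpace ℝ (Fin N) → ℝ, ContDiff ℝ ∞ φ → HasCompactSupport φ →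
      tsupport φ ⊆ Ω → (∀ x, 0 ≤ φ x) →
        -∫ x in Ω, w x * (Δ φ) x ≤ ∫ x in Ω, f x * φ x

/-! The proof has a qualitative half (local boundedness) and a quantitative half (point-picking),
both based on a mean value inequality. Average u against the mass-preserving dilates of -2g'(|z|²).
The t-derivative of this average is t ∫ u Δφ_t with φ_t(y) = t⁻ᴺ g(|y - x|²/t²), an admissible test
function, so it is at least -t ∫ f φ_t. Letting t → 0 at Lebesgue points gives u(x) ≤ C r⁻ᴺ
∫_{B_r(x)} u + C ∫₀ʳ t¹⁻ᴺ ∫_{B_t(x)} f dt (`exists_mean_value_inequality`).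

Boundedness (`IsNonnegSubsolution.exists_ae_le_of_norm_lt`): for N ≥ 2 the source term is dominated
by a truncated Riesz potential of u^(p-1) = V u, where V = u^(p-2) lies in Lˢ for some s > N/2
because q > (p-2)N/2. At a small radius the potential of V is small, and the three-kernel inequality
lets the potential of V u be absorbed into itself. The bound depends on u; it serves only to make a
supremum finite.

Smallness (`IsNonnegSubsolution.exists_smallness`): choose x nearly maximising (R₁ - |x|)^(N/q)
u(x). On a ball of radius r at most half of R₁ - |x|, u ≤ L u(x). If also r² ≤ c² u(x)^(-(p-2)), the
source term is at most u(x)/4 and u(x)^q rᴺ ≤ K δ. Take r to be the smaller of the two limits. In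
the first case the weighted maximum is small; in the second u(x)^κ ≤ K δ / cᴺ with κ = q - (p-2)N/2
> 0, against a lower bound for u(x). -/

/-! ### Radial cutoffs and their dilates -/

/-- The Laplacian of a radial function written through the squared distance to `x`. -/
theorem laplacian_comp_norm_sub_sq {N : ℕ} {g : ℝ → ℝ} (hg : ContDiff ℝ ∞ g)
    (x y : EuclideanSpace ℝ (Fin N)) :
    (Δ (fun z : EuclideanSpace ℝ (Fin N) => g (‖z - x‖ ^ 2))) y =
      4 * ‖y - x‖ ^ 2 * deriv (deriv g) (‖y - x‖ ^ 2) + 2 * N * deriv g (‖y - x‖ ^ 2) := by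
  have hg1 : ContDiff ℝ ∞ (deriv g) := ((contDiff_succ_iff_deriv (n := ∞)).1 hg).2.2
  have hsq : ∀ z : EuclideanSpace ℝ (Fin N), HasFDerivAt (fun z => ‖z - x‖ ^ 2)
      (2 • (innerSL ℝ (z - x))) z := fun z => by
    have := ((hasStrictFDerivAt_norm_sq (z - x)).hasFDerivAt).comp z
      ((hasFDerivAt_id z).sub_const x)
    exact this
  have hcomp : ∀ (k : ℝ → ℝ), ContDiff ℝ ∞ k → ∀ z, HasFDerivAt
      (fun z : EuclideanSpace ℝ (Fin N) => k (‖z - x‖ ^ 2))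
      (deriv k (‖z - x‖ ^ 2) • (2 • (innerSL ℝ (z - x)))) z := fun k hk z => by
    have h1 : HasDerivAt k (deriv k (‖z - x‖ ^ 2)) (‖z - x‖ ^ 2) :=
      ((hk.differentiable (by simp)) _).hasDerivAt
    exact h1.comp_hasFDerivAt z (hsq z)
  have hfd : fderiv ℝ (fun z : EuclideanSpace ℝ (Fin N) => g (‖z - x‖ ^ 2)) =
      fun z => deriv g (‖z - x‖ ^ 2) • ((2 : ℕ) • (innerSL ℝ (z - x))) :=
    funext fun z => (hcomp g hg z).fderiv
  have hin : HasFDerivAt (fun z : EuclideanSpace ℝ (Fin N) => (2 : ℕ) • (innerSL ℝ (z - x)))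
      ((2 : ℕ) • (innerSL ℝ)) y := by
    have := ((innerSL ℝ (E := EuclideanSpace ℝ (Fin N))).hasFDerivAt (x := y - x)).comp y
      ((hasFDerivAt_id y).sub_const x)
    exact this.const_smul (2 : ℕ)
  have hfd2 := ((hcomp _ hg1 y).smul hin).fderiv
  rw [InnerProductSpace.laplacian_eq_iteratedFDeriv_orthonormalBasis _
    (EuclideanSpace.basisFun (Fin N) ℝ)]
  simp only [iteratedFDeriv_two_apply, hfd]
  change ∑ i, (fderiv ℝ ((fun z => deriv g (‖z - x‖ ^ 2)) • fun z => (2 : ℕ) • (innerSL ℝ (z - x)))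
    y) _ _ = _
  rw [hfd2]
  have e : ∀ i : Fin N, (innerSL ℝ (EuclideanSpace.single i (1 : ℝ)))
      (EuclideanSpace.single i (1 : ℝ)) = (1 : ℝ) := fun i => by
    change inner ℝ (EuclideanSpace.single i (1 : ℝ)) (EuclideanSpace.single i (1 : ℝ)) = (1 : ℝ)
    simp
  simp [EuclideanSpace.inner_single_right, Finset.sum_add_distrib, e]
  rw [EuclideanSpace.norm_sq_eq, Finset.mul_sum, Finset.sum_mul]
  simp only [Real.norm_eq_abs, sq_abs, PiLp.sub_apply]
  rw [add_comm]
  congr 1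
  · refine Finset.sum_congr rfl fun i _ => ?_
    ring
  · ring

/-- A smooth nonincreasing function on the line that vanishes on `[1, ∞)`. -/
noncomputable def cutoffProfile (s : ℝ) : ℝ := expNegInvGlue (1 - s)

theorem contDiff_cutoffProfile : ContDiff ℝ ∞ cutoffProfile :=
  expNegInvGlue.contDiff.comp (contDiff_const.sub contDiff_id)

theorem contDiff_deriv_cutoffProfile : ContDiff ℝ ∞ (deriv cutoffProfile) :=
  ((contDiff_succ_iff_deriv (n := ∞)).1 contDiff_cutoffProfile).2.2

theorem contDiff_deriv_deriv_cutoffProfile : ContDiff ℝ ∞ (deriv (deriv cutoffProfile)) :=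
  ((contDiff_succ_iff_deriv (n := ∞)).1 contDiff_deriv_cutoffProfile).2.2

theorem cutoffProfile_nonneg (s : ℝ) : 0 ≤ cutoffProfile s := expNegInvGlue.nonneg _

theorem cutoffProfile_of_one_le {s : ℝ} (hs : 1 ≤ s) : cutoffProfile s = 0 :=
  expNegInvGlue.zero_of_nonpos (by linarith)

theorem antitone_cutoffProfile : Antitone cutoffProfile := fun _ _ h =>
  expNegInvGlue.monotone (by linarith)

theorem deriv_cutoffProfile_nonpos (s : ℝ) : deriv cutoffProfile s ≤ 0 :=
  antitone_cutoffProfile.deriv_nonpos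

theorem deriv_eq_zero_of_one_le {g : ℝ → ℝ} (hg : Continuous (deriv g))
    (h : ∀ s, 1 ≤ s → g s = 0) {s : ℝ} (hs : 1 ≤ s) : deriv g s = 0 := by
  have h1 : ∀ t ∈ Set.Ioi (1 : ℝ), deriv g t = 0 := fun t ht => by
    have : g =ᶠ[nhds t] fun _ => 0 := by
      filter_upwards [Ioi_mem_nhds ht] with z hz using h z (le_of_lt hz)
    rw [this.deriv_eq]; simp
  have h2 : IsClosed {t | deriv g t = 0} := isClosed_eq hg continuous_const
  have h3 := closure_minimal (s := Set.Ioi (1 : ℝ)) h1 h2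
  rw [closure_Ioi] at h3
  exact h3 hs

theorem deriv_cutoffProfile_of_one_le {s : ℝ} (hs : 1 ≤ s) : deriv cutoffProfile s = 0 :=
  deriv_eq_zero_of_one_le contDiff_deriv_cutoffProfile.continuous
    (fun _ => cutoffProfile_of_one_le) hs

theorem deriv_deriv_cutoffProfile_of_one_le {s : ℝ} (hs : 1 ≤ s) :
    deriv (deriv cutoffProfile) s = 0 :=
  deriv_eq_zero_of_one_le contDiff_deriv_deriv_cutoffProfile.continuous
    (fun _ => deriv_cutoffProfile_of_one_le) hs

theorem exists_deriv_cutoffProfile_neg : ∃ s, 0 < s ∧ deriv cutoffProfile s < 0 := by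
  obtain ⟨c, hc, hc'⟩ := exists_deriv_eq_slope cutoffProfile zero_lt_one
    contDiff_cutoffProfile.continuous.continuousOn
    (contDiff_cutoffProfile.differentiable (by simp)).differentiableOn
  refine ⟨c, hc.1, ?_⟩
  rw [hc', cutoffProfile_of_one_le le_rfl]
  have : 0 < cutoffProfile 0 := expNegInvGlue.pos_of_pos (by norm_num)
  simpa using this

theorem exists_abs_le_of_vanishing {g : ℝ → ℝ} (hg : Continuous g)
    (h : ∀ s, 1 ≤ s → g s = 0) : ∃ C, 0 < C ∧ ∀ s, 0 ≤ s → |g s| ≤ C := by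
  obtain ⟨C, hC⟩ := (isCompact_Icc (a := (0 : ℝ)) (b := 1)).exists_bound_of_continuousOn
    hg.continuousOn
  refine ⟨max C 1, by positivity, fun s hs => ?_⟩
  rcases le_total s 1 with h1 | h1
  · exact (hC s ⟨hs, h1⟩).trans (le_max_left _ _)
  · rw [h s h1]; simp

/-- A constant bounding the cutoff profile and its first two derivatives on `[0, ∞)`. -/
theorem exists_bound_cutoffProfile : ∃ C, 0 < C ∧ ∀ s, 0 ≤ s → |cutoffProfile s| ≤ C ∧
    |deriv cutoffProfile s| ≤ C ∧ |deriv (deriv cutoffProfile) s| ≤ C := by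
  obtain ⟨A, hA, hA'⟩ := exists_abs_le_of_vanishing contDiff_cutoffProfile.continuous
    fun _ => cutoffProfile_of_one_le
  obtain ⟨B, hB, hB'⟩ := exists_abs_le_of_vanishing contDiff_deriv_cutoffProfile.continuous
    fun _ => deriv_cutoffProfile_of_one_le
  obtain ⟨D, hD, hD'⟩ := exists_abs_le_of_vanishing contDiff_deriv_deriv_cutoffProfile.continuous
    fun _ => deriv_deriv_cutoffProfile_of_one_le
  refine ⟨A + B + D, by positivity, fun s hs => ⟨?_, ?_, ?_⟩⟩
  · linarith [hA' s hs]
  · linarith [hB' s hs]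
  · linarith [hD' s hs]

/-- The kernel `t⁻ᴺ g(|y - x|² / t²)`. -/
noncomputable def radialKernel {N : ℕ} (g : ℝ → ℝ) (t : ℝ) (x y : EuclideanSpace ℝ (Fin N)) : ℝ :=
  (t ^ N)⁻¹ * g (‖y - x‖ ^ 2 / t ^ 2)

section RadialKernel

variable {N : ℕ} {g : ℝ → ℝ} {t : ℝ} {x y : EuclideanSpace ℝ (Fin N)}

theorem radialKernel_eq_zero (h : ∀ s, 1 ≤ s → g s = 0) (ht : 0 < t) (hy : t ≤ ‖y - x‖) :
    radialKernel g t x y = 0 := by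
  rw [radialKernel, h, mul_zero]
  rw [le_div_iff₀ (by positivity), one_mul]
  gcongr

theorem contDiff_radialKernel (hg : ContDiff ℝ ∞ g) (t : ℝ) (x : EuclideanSpace ℝ (Fin N)) :
    ContDiff ℝ ∞ (radialKernel g t x) := by
  unfold radialKernel
  exact contDiff_const.mul (hg.comp
    (((contDiff_id.sub contDiff_const).norm_sq ℝ).div_const _))

theorem tsupport_radialKernel_subset (h : ∀ s, 1 ≤ s → g s = 0) (ht : 0 < t) :
    tsupport (radialKernel g t x) ⊆ closedBall x t := by
  refine closure_minimal (fun y hy => ?_) isClosed_closedBall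
  by_contra hy'
  rw [mem_closedBall, dist_eq_norm, not_le] at hy'
  exact hy (radialKernel_eq_zero h ht hy'.le)

theorem laplacian_radialKernel (hg : ContDiff ℝ ∞ g) (t : ℝ) (x y : EuclideanSpace ℝ (Fin N)) :
    (Δ (radialKernel g t x)) y = (t ^ N)⁻¹ * (4 * ‖y - x‖ ^ 2 / t ^ 4 *
      deriv (deriv g) (‖y - x‖ ^ 2 / t ^ 2) + 2 * N / t ^ 2 * deriv g (‖y - x‖ ^ 2 / t ^ 2)) := by
  have hd : ∀ k : ℝ → ℝ, Differentiable ℝ k → ∀ a b : ℝ, deriv (fun s => a * k (s / b)) =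
      fun s => a / b * deriv k (s / b) := fun k hk a b => by
    funext s
    have h1 : HasDerivAt (fun s : ℝ => s / b) (1 / b) s := (hasDerivAt_id s).div_const b
    have h2 := (((hk (s / b)).hasDerivAt).comp s h1).const_mul a
    have h3 := h2.deriv
    simp only [Function.comp_def] at h3
    rw [h3]; ring
  have hg1 : ContDiff ℝ ∞ (deriv g) := ((contDiff_succ_iff_deriv (n := ∞)).1 hg).2.2
  have hG : ContDiff ℝ ∞ (fun s => (t ^ N)⁻¹ * g (s / t ^ 2)) :=
    contDiff_const.mul (hg.comp (contDiff_id.div_const _))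
  have := laplacian_comp_norm_sub_sq hG x y
  rw [hd g (hg.differentiable (by simp)), hd _ (hg1.differentiable (by simp))] at this
  unfold radialKernel
  rw [this]
  ring

/-- With h = -2g', the gradient in y of the g-kernel is -(y - x)/t² times the h-kernel.
Mass-preserving dilation satisfies ∂_t K_h = -t⁻¹ div((y - x) K_h), which is therefore t Δ K_g. -/
theorem hasDerivAt_radialKernel (hg : ContDiff ℝ ∞ g) (ht : 0 < t) :
    HasDerivAt (fun t => radialKernel (fun s => -2 * deriv g s) t x y)
      (t * (Δ (radialKernel g t x)) y) t := by
  have hg1 : ContDiff ℝ ∞ (deriv g) := ((contDiff_succ_iff_deriv (n := ∞)).1 hg).2.2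
  have h1 : HasDerivAt (fun t : ℝ => (t ^ N)⁻¹) (-(N * t ^ (N - 1)) / (t ^ N) ^ 2) t :=
    (hasDerivAt_pow N t).inv (by positivity)
  have h2 : HasDerivAt (fun t : ℝ => ‖y - x‖ ^ 2 / t ^ 2)
      (‖y - x‖ ^ 2 * (-(2 * t) / (t ^ 2) ^ 2)) t := by
    have := ((hasDerivAt_pow 2 t).inv (by positivity)).const_mul (‖y - x‖ ^ 2)
    simpa [div_eq_mul_inv] using this
  have h3 := ((((hg1.differentiable (by simp)) (‖y - x‖ ^ 2 / t ^ 2)).hasDerivAt).comp t h2).const_mul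
    (-2)
  have h4 := h1.mul h3
  unfold radialKernel
  refine h4.congr_deriv ?_
  have := laplacian_radialKernel hg t x y
  unfold radialKernel at this
  rw [this]
  simp only [Function.comp_def]
  have hN : (N : ℝ) * t ^ (N - 1) = N * t ^ N / t := by
    rcases N with _ | n
    · simp
    · simp [pow_succ]; field_simp
  rw [hN]
  field_simp
  ring

theorem abs_radialKernel_le {C : ℝ} (hC : ∀ s, 0 ≤ s → |g s| ≤ C) (ht : 0 < t) :
    |radialKernel g t x y| ≤ C / t ^ N := by
  rw [radialKernel, abs_mul, abs_of_pos (by positivity : 0 < (t ^ N)⁻¹), mul_comm, div_eq_mul_inv]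
  exact mul_le_mul_of_nonneg_right (hC _ (by positivity)) (by positivity)

theorem radialKernel_nonneg (hg : ∀ s, 0 ≤ g s) (ht : 0 < t) : 0 ≤ radialKernel g t x y :=
  mul_nonneg (by positivity) (hg _)

theorem continuousOn_radialKernel (hg : Continuous g) (y : EuclideanSpace ℝ (Fin N)) :
    ContinuousOn (fun t => radialKernel g t x y) (Set.Ioi 0) := by
  unfold radialKernel
  refine ContinuousOn.mul ?_ (hg.comp_continuousOn ?_)
  · exact (continuousOn_id.pow N).inv₀ fun t ht => pow_ne_zero _ (ne_of_gt ht)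
  · exact continuousOn_const.div (continuousOn_id.pow 2) fun t ht => pow_ne_zero _ (ne_of_gt ht)

theorem integral_radialKernel (g : ℝ → ℝ) (ht : 0 < t) (x : EuclideanSpace ℝ (Fin N)) :
    ∫ y, radialKernel g t x y = ∫ z : EuclideanSpace ℝ (Fin N), g (‖z‖ ^ 2) := by
  have h1 : ∀ y, radialKernel g t x y = (t ^ N)⁻¹ * (fun z => g (‖t⁻¹ • z‖ ^ 2)) (y - x) := by
    intro y
    simp only [radialKernel, norm_smul, norm_inv, Real.norm_eq_abs, mul_pow, inv_pow, sq_abs]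
    rw [div_eq_inv_mul]
  simp_rw [h1]
  rw [integral_const_mul, integral_sub_right_eq_self (fun z => g (‖t⁻¹ • z‖ ^ 2)) x,
    Measure.integral_comp_inv_smul volume (fun z => g (‖z‖ ^ 2)) t, finrank_euclideanSpace_fin,
    smul_eq_mul, abs_of_pos (by positivity), ← mul_assoc, inv_mul_cancel₀ (by positivity), one_mul]

end RadialKernel

theorem integral_deriv_cutoffProfile_pos (N : ℕ) (hN : 1 ≤ N) :
    0 < ∫ z : EuclideanSpace ℝ (Fin N), -2 * deriv cutoffProfile (‖z‖ ^ 2) := by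
  have hc : Continuous fun z : EuclideanSpace ℝ (Fin N) => -2 * deriv cutoffProfile (‖z‖ ^ 2) :=
    continuous_const.mul (contDiff_deriv_cutoffProfile.continuous.comp (by fun_prop))
  have hs : HasCompactSupport fun z : EuclideanSpace ℝ (Fin N) =>
      -2 * deriv cutoffProfile (‖z‖ ^ 2) := by
    refine HasCompactSupport.intro (isCompact_closedBall 0 1) fun z hz => ?_
    rw [mem_closedBall_zero_iff, not_le] at hz
    rw [deriv_cutoffProfile_of_one_le (by nlinarith), mul_zero]
  obtain ⟨s, hs0, hs1⟩ := exists_deriv_cutoffProfile_neg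
  refine hc.integral_pos_of_hasCompactSupport_nonneg_nonzero hs
    (fun z => by simpa using by linarith [deriv_cutoffProfile_nonpos (‖z‖ ^ 2)])
    -- Since N ≥ 1, some vector has norm √s, where the integrand is positive.
    (x := EuclideanSpace.single ⟨0, hN⟩ (Real.sqrt s)) ?_
  simp [Real.sq_sqrt hs0.le, hs1.ne]

/-! ### The mean value inequality with source -/

/-- `u` and `f` are nonnegative and integrable on the whole space, and `-Δ u ≤ f` in the sense of
distributions in the ball of radius `R`. -/
structure IsNonnegSubsolution {N : ℕ} (R : ℝ) (u f : EuclideanSpace ℝ (Fin N) → ℝ) : Prop where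
  integrable : Integrable u
  integrable_source : Integrable f
  nonneg : ∀ x, 0 ≤ u x
  source_nonneg : ∀ x, 0 ≤ f x
  neg_laplacian_le : ∀ φ : EuclideanSpace ℝ (Fin N) → ℝ, ContDiff ℝ ∞ φ → HasCompactSupport φ →
    tsupport φ ⊆ ball 0 R → (∀ x, 0 ≤ φ x) → -∫ x, u x * (Δ φ) x ≤ ∫ x, f x * φ x

section KernelAverage

variable {N : ℕ} {u f : EuclideanSpace ℝ (Fin N) → ℝ}

theorem ofReal_integral_mul_radialKernel_le {g : ℝ → ℝ} {C t : ℝ} (hu : ∀ x, 0 ≤ u x)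
    (hg : ∀ s, 1 ≤ s → g s = 0) (hC : ∀ s, 0 ≤ s → |g s| ≤ C) (ht : 0 < t)
    (x : EuclideanSpace ℝ (Fin N)) :
    ENNReal.ofReal (∫ y, u y * radialKernel g t x y) ≤
      ENNReal.ofReal (C / t ^ N) * ∫⁻ y in ball x t, ENNReal.ofReal (u y) := by
  calc ENNReal.ofReal (∫ y, u y * radialKernel g t x y)
      ≤ ‖∫ y, u y * radialKernel g t x y‖ₑ := Real.ofReal_le_enorm _
    _ ≤ ∫⁻ y, ‖u y * radialKernel g t x y‖ₑ := enorm_integral_le_lintegral_enorm _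
    _ ≤ ∫⁻ y, (ball x t).indicator
          (fun y => ENNReal.ofReal (C / t ^ N) * ENNReal.ofReal (u y)) y := by
        refine lintegral_mono fun y => ?_
        by_cases hy : y ∈ ball x t
        · rw [Set.indicator_of_mem hy, enorm_mul, mul_comm, Real.enorm_of_nonneg (hu y)]
          gcongr
          rw [Real.enorm_eq_ofReal_abs]
          exact ENNReal.ofReal_le_ofReal (abs_radialKernel_le hC ht)
        · rw [mem_ball, dist_eq_norm, not_lt] at hy
          simp [radialKernel_eq_zero hg ht hy]
    _ = _ := by
        rw [lintegral_indicator measurableSet_ball, lintegral_const_mul' _ _ ENNReal.ofReal_ne_top]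

theorem integrable_mul_radialKernel {g : ℝ → ℝ} {C t : ℝ} (hu : Integrable u)
    (hg : Continuous g) (hC : ∀ s, 0 ≤ s → |g s| ≤ C) (ht : 0 < t)
    (x : EuclideanSpace ℝ (Fin N)) : Integrable fun y => u y * radialKernel g t x y := by
  refine hu.mul_bdd (c := C / t ^ N) ?_ (Filter.Eventually.of_forall fun y => ?_)
  · unfold radialKernel
    exact (by fun_prop : Continuous fun y => (t ^ N)⁻¹ * g (‖y - x‖ ^ 2 / t ^ 2)).aestronglyMeasurable
  · exact abs_radialKernel_le hC ht

theorem laplacian_radialKernel_eq {g : ℝ → ℝ} (hg : ContDiff ℝ ∞ g) (t : ℝ)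
    (x y : EuclideanSpace ℝ (Fin N)) : (Δ (radialKernel g t x)) y =
      radialKernel (fun s => 4 * s * deriv (deriv g) s + 2 * N * deriv g s) t x y / t ^ 2 := by
  rw [laplacian_radialKernel hg, radialKernel]
  ring

theorem hasDerivAt_integral_radialKernel (hu : Integrable u) (x : EuclideanSpace ℝ (Fin N)) {t : ℝ}
    (ht : 0 < t) :
    HasDerivAt (fun t => ∫ y, u y * radialKernel (fun s => -2 * deriv cutoffProfile s) t x y)
      (t * ∫ y, u y * (Δ (radialKernel cutoffProfile t x)) y) t := by
  -- `k` is the profile of t² Δ of the cutoff kernel; it vanishes past 1, hence is bounded on [0,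
  -- ∞).
  set k : ℝ → ℝ := fun s => 4 * s * deriv (deriv cutoffProfile) s + 2 * N * deriv cutoffProfile s
    with hk
  have c1 := contDiff_deriv_cutoffProfile.continuous
  have c2 := contDiff_deriv_deriv_cutoffProfile.continuous
  have hkc : Continuous k := by fun_prop
  obtain ⟨C, hC0, hC⟩ := exists_abs_le_of_vanishing hkc fun s hs => by
    simp [hk, deriv_cutoffProfile_of_one_le hs, deriv_deriv_cutoffProfile_of_one_le hs]
  obtain ⟨D, hD0, hD⟩ := exists_bound_cutoffProfile
  have hD' : ∀ s, 0 ≤ s → |-2 * deriv cutoffProfile s| ≤ 2 * D := fun s hs => by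
    rw [abs_mul]; norm_num; exact (hD s hs).2.1
  have key := (hasDerivAt_integral_of_dominated_loc_of_deriv_le (μ := volume)
    (F := fun t y => u y * radialKernel (fun s => -2 * deriv cutoffProfile s) t x y)
    (F' := fun t y => u y * (t * (Δ (radialKernel cutoffProfile t x)) y))
    -- Staying above t / 2 keeps the singular factors τ⁻ᴺ and τ⁻¹ uniformly bounded.
    (bound := fun y => |u y| * (C / (t / 2) ^ N / (t / 2))) (x₀ := t)
    (s := Set.Ioi (t / 2)) (Ioi_mem_nhds (by linarith)) ?_ ?_ ?_ ?_ ?_ ?_).2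
  · refine key.congr_deriv ?_
    rw [← integral_const_mul]
    congr 1; funext y; ring
  · filter_upwards [Ioi_mem_nhds ht] with τ hτ
    exact (integrable_mul_radialKernel hu (by fun_prop) hD' hτ x).aestronglyMeasurable
  · exact integrable_mul_radialKernel hu (by fun_prop) hD' ht x
  · have := (integrable_mul_radialKernel hu hkc hC ht x).mul_const (t / t ^ 2)
    refine this.aestronglyMeasurable.congr (Filter.Eventually.of_forall fun y => ?_)
    simp only [laplacian_radialKernel_eq contDiff_cutoffProfile, ← hk]
    ring
  · refine Filter.Eventually.of_forall fun y τ hτ => ?_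
    have hτ' : t / 2 < τ := hτ
    have hτ0 : 0 < τ := by linarith
    rw [laplacian_radialKernel_eq contDiff_cutoffProfile, ← hk, Real.norm_eq_abs, abs_mul]
    gcongr
    have h1 : |radialKernel k τ x y| ≤ C / (t / 2) ^ N :=
      (abs_radialKernel_le hC hτ0).trans (by gcongr)
    have h2 : τ * (radialKernel k τ x y / τ ^ 2) = radialKernel k τ x y / τ := by
      field_simp
    rw [h2, abs_div, abs_of_pos hτ0]
    gcongr
  · exact hu.abs.mul_const _
  · refine Filter.Eventually.of_forall fun y τ hτ => ?_
    have hτ' : t / 2 < τ := hτ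
    exact (hasDerivAt_radialKernel contDiff_cutoffProfile (by linarith)).const_mul (u y)

theorem continuousOn_integral_radialKernel (hf : Integrable f) (x : EuclideanSpace ℝ (Fin N))
    {s r : ℝ} (hs : 0 < s) : ContinuousOn
      (fun t => t * ∫ y, f y * radialKernel cutoffProfile t x y) (Set.Icc s r) := by
  obtain ⟨D, hD0, hD⟩ := exists_bound_cutoffProfile
  refine continuousOn_id.mul (continuousOn_of_dominated (bound := fun y => |f y| * (D / s ^ N))
    ?_ ?_ (hf.abs.mul_const _) ?_)
  · exact fun t ht => (integrable_mul_radialKernel hf contDiff_cutoffProfile.continuous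
      (fun a ha => (hD a ha).1) (hs.trans_le ht.1) x).aestronglyMeasurable
  · refine fun t ht => Filter.Eventually.of_forall fun y => ?_
    rw [Real.norm_eq_abs, abs_mul]
    have hst : s ≤ t := ht.1
    gcongr
    exact (abs_radialKernel_le (fun a ha => (hD a ha).1) (hs.trans_le ht.1)).trans (by gcongr)
  · refine Filter.Eventually.of_forall fun y => continuousOn_const.mul ?_
    exact (continuousOn_radialKernel contDiff_cutoffProfile.continuous y).mono
      fun t ht => hs.trans_le ht.1

/-- Testing the inequality with the cutoff kernel at scale t bounds the derivative of minus the
average by the source integrand; integrate from s to r. The condition ‖x‖ + r < R keeps the supports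
inside the ball. -/
theorem IsNonnegSubsolution.integral_radialKernel_le {R : ℝ} (h : IsNonnegSubsolution R u f)
    {x : EuclideanSpace ℝ (Fin N)} {s r : ℝ} (hs : 0 < s) (hsr : s ≤ r) (hx : ‖x‖ + r < R) :
    ∫ y, u y * radialKernel (fun s => -2 * deriv cutoffProfile s) s x y ≤
      (∫ y, u y * radialKernel (fun s => -2 * deriv cutoffProfile s) r x y) +
        ∫ t in s..r, t * ∫ y, f y * radialKernel cutoffProfile t x y := by
  have hd : ∀ t, 0 < t → HasDerivAt
      (fun t => -∫ y, u y * radialKernel (fun s => -2 * deriv cutoffProfile s) t x y)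
      (-(t * ∫ y, u y * (Δ (radialKernel cutoffProfile t x)) y)) t := fun t ht =>
    (hasDerivAt_integral_radialKernel h.integrable x ht).neg
  have key := intervalIntegral.sub_le_integral_of_hasDeriv_right_of_le hsr
    (fun t ht => (hd t (hs.trans_le ht.1)).continuousAt.continuousWithinAt)
    (fun t ht => (hd t (hs.trans ht.1)).hasDerivWithinAt)
    ((continuousOn_integral_radialKernel h.integrable_source x hs).integrableOn_compact isCompact_Icc)
    (fun t ht => by
      have ht0 : 0 < t := hs.trans ht.1
      have hsupp := tsupport_radialKernel_subset (x := x) (fun _ => cutoffProfile_of_one_le) ht0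
      have := h.neg_laplacian_le _ (contDiff_radialKernel contDiff_cutoffProfile t x)
        ((isCompact_closedBall x t).of_isClosed_subset (isClosed_tsupport _) hsupp)
        (hsupp.trans fun y hy => ?_) (fun y => radialKernel_nonneg cutoffProfile_nonneg ht0)
      · rw [← mul_neg]
        exact mul_le_mul_of_nonneg_left this ht0.le
      · rw [mem_ball_zero_iff]
        rw [mem_closedBall, dist_eq_norm] at hy
        have : ‖y‖ ≤ ‖y - x‖ + ‖x‖ := by simpa using norm_add_le (y - x) x
        linarith [ht.2])
  linarith

/-- The kernels have constant mass, height O(t⁻ᴺ) and support in a ball of radius t, so the error at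
a Lebesgue point is at most a constant times the mean oscillation. -/
theorem ae_tendsto_integral_radialKernel (hu : Integrable u) :
    ∀ᵐ x, Filter.Tendsto
      (fun t => ∫ y, u y * radialKernel (fun s => -2 * deriv cutoffProfile s) t x y)
      (nhdsWithin 0 (Set.Ioi 0))
      (nhds (u x * ∫ z : EuclideanSpace ℝ (Fin N), -2 * deriv cutoffProfile (‖z‖ ^ 2))) := by
  obtain ⟨D, hD0, hD⟩ := exists_bound_cutoffProfile
  have hD' : ∀ s, 0 ≤ s → |-2 * deriv cutoffProfile s| ≤ 2 * D := fun s hs => by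
    rw [abs_mul]; norm_num; exact (hD s hs).2.1
  have c1 := contDiff_deriv_cutoffProfile.continuous
  filter_upwards [IsUnifLocDoublingMeasure.ae_tendsto_average_norm_sub volume
    hu.locallyIntegrable 1] with x hx
  have hx := hx (fun _ : ℝ => x) (fun t => t) Filter.tendsto_id (by
    filter_upwards [self_mem_nhdsWithin] with t ht
    simpa using (le_of_lt ht))
  rw [tendsto_iff_norm_sub_tendsto_zero]
  set v := volume.real (ball (0 : EuclideanSpace ℝ (Fin N)) 1)
  have hx' := hx.const_mul (2 * D * v)
  rw [mul_zero] at hx'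
  refine squeeze_zero' (Filter.Eventually.of_forall fun _ => norm_nonneg _) ?_ hx'
  filter_upwards [self_mem_nhdsWithin] with t ht
  have ht : 0 < t := ht
  have hint := integrable_mul_radialKernel hu (g := fun s => -2 * deriv cutoffProfile s)
    (by fun_prop) hD' ht x
  have hvan : ∀ s, 1 ≤ s → -2 * deriv cutoffProfile s = 0 := fun s hs => by
    simp [deriv_cutoffProfile_of_one_le hs]
  have hker : Integrable (radialKernel (fun s => -2 * deriv cutoffProfile s) t x) := by
    refine Continuous.integrable_of_hasCompactSupport ?_
      ((isCompact_closedBall x t).of_isClosed_subset (isClosed_tsupport _)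
        (tsupport_radialKernel_subset hvan ht))
    unfold radialKernel
    fun_prop
  have hvol : volume.real (closedBall x t) = t ^ N * v := by
    have := Measure.addHaar_real_closedBall (μ := volume) x ht.le
    rw [this, finrank_euclideanSpace_fin]
  have hv : 0 < v := by
    exact ENNReal.toReal_pos (measure_ball_pos _ _ one_pos).ne' measure_ball_lt_top.ne
  rw [← integral_radialKernel (fun s => -2 * deriv cutoffProfile s) ht x, ← integral_const_mul,
    ← integral_sub hint (hker.const_mul _)]
  refine (norm_integral_le_integral_norm _).trans ?_
  have h1 : ∀ y, ‖u y * radialKernel (fun s => -2 * deriv cutoffProfile s) t x y -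
      u x * radialKernel (fun s => -2 * deriv cutoffProfile s) t x y‖ ≤
      (closedBall x t).indicator (fun y => 2 * D / t ^ N * ‖u y - u x‖) y := fun y => by
    rw [← sub_mul, norm_mul]
    by_cases hy : y ∈ closedBall x t
    · rw [Set.indicator_of_mem hy, mul_comm]
      gcongr
      exact abs_radialKernel_le hD' ht
    · rw [mem_closedBall, dist_eq_norm, not_le] at hy
      rw [radialKernel_eq_zero hvan ht hy.le, norm_zero, mul_zero]
      exact Set.indicator_nonneg (fun _ _ => by positivity) _
  have hI : IntegrableOn (fun y => 2 * D / t ^ N * ‖u y - u x‖) (closedBall x t) :=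
    ((hu.integrableOn.sub (integrableOn_const measure_closedBall_lt_top.ne)).norm).const_mul _
  refine (integral_mono (hint.sub (hker.const_mul _)).norm
    ((integrable_indicator_iff measurableSet_closedBall).2 hI) h1).trans (le_of_eq ?_)
  rw [integral_indicator measurableSet_closedBall, integral_const_mul, setAverage_eq, hvol,
    smul_eq_mul]
  field_simp

/-- A mean value inequality with source term for distributional subsolutions. -/
theorem exists_mean_value_inequality (N : ℕ) (hN : 1 ≤ N) : ∃ C : ℝ, 0 < C ∧
    ∀ (R : ℝ) (u f : EuclideanSpace ℝ (Fin N) → ℝ), IsNonnegSubsolution R u f →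
      ∀ᵐ x, ∀ r, 0 < r → ‖x‖ + r < R → ENNReal.ofReal (u x) ≤
        ENNReal.ofReal (C / r ^ N) * (∫⁻ y in ball x r, ENNReal.ofReal (u y)) +
          ∫⁻ t in Set.Ioc 0 r, ENNReal.ofReal (C * (t / t ^ N)) *
            ∫⁻ y in ball x t, ENNReal.ofReal (f y) := by
  obtain ⟨D, hD0, hD⟩ := exists_bound_cutoffProfile
  have hD' : ∀ s, 0 ≤ s → |-2 * deriv cutoffProfile s| ≤ 2 * D := fun s hs => by
    rw [abs_mul]; norm_num; exact (hD s hs).2.1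
  have hvan : ∀ s, 1 ≤ s → -2 * deriv cutoffProfile s = 0 := fun s hs => by
    simp [deriv_cutoffProfile_of_one_le hs]
  set c := ∫ z : EuclideanSpace ℝ (Fin N), -2 * deriv cutoffProfile (‖z‖ ^ 2)
  have hc : 0 < c := integral_deriv_cutoffProfile_pos N hN
  refine ⟨2 * D / c, by positivity, fun R u f h => ?_⟩
  filter_upwards [ae_tendsto_integral_radialKernel h.integrable] with x hx r hr hxr
  have hlim := (ENNReal.continuous_ofReal.tendsto _).comp hx
  have hle : ENNReal.ofReal (u x * c) ≤
      ENNReal.ofReal (2 * D / r ^ N) * (∫⁻ y in ball x r, ENNReal.ofReal (u y)) +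
          ∫⁻ t in Set.Ioc 0 r, ENNReal.ofReal (2 * D * (t / t ^ N)) *
            ∫⁻ y in ball x t, ENNReal.ofReal (f y) := by
    refine le_of_tendsto hlim ?_
    -- The right-hand side does not depend on s, so it suffices to bound the averages for 0 < s ≤ r.
    filter_upwards [Ioc_mem_nhdsGT hr] with s hs
    refine (ENNReal.ofReal_le_ofReal (h.integral_radialKernel_le hs.1 hs.2 hxr)).trans ?_
    refine ENNReal.ofReal_add_le.trans (add_le_add
      (ofReal_integral_mul_radialKernel_le h.nonneg hvan hD' hr x) ?_)
    rw [intervalIntegral.integral_of_le hs.2]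
    refine (Real.ofReal_le_enorm _).trans ((enorm_integral_le_lintegral_enorm _).trans ?_)
    refine (lintegral_mono_set (Set.Ioc_subset_Ioc_left hs.1.le)).trans ?_
    refine setLIntegral_mono' measurableSet_Ioc fun t ht => ?_
    have ht0 : 0 < t := ht.1
    have hnn : 0 ≤ ∫ y, f y * radialKernel cutoffProfile t x y :=
      integral_nonneg fun y => mul_nonneg (h.source_nonneg y)
        (radialKernel_nonneg cutoffProfile_nonneg ht0)
    rw [Real.enorm_of_nonneg (mul_nonneg ht0.le hnn), ENNReal.ofReal_mul ht0.le]
    have := ofReal_integral_mul_radialKernel_le h.source_nonneg (g := cutoffProfile) (C := 2 * D)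
      (fun _ => cutoffProfile_of_one_le) (fun s hs => by linarith [(hD s hs).1]) ht0 x
    refine (mul_le_mul_right this _).trans ?_
    rw [← mul_assoc, ← ENNReal.ofReal_mul ht0.le]
    refine le_of_eq ?_
    congr 2
    ring
  have e : ENNReal.ofReal (u x) = ENNReal.ofReal c⁻¹ * ENNReal.ofReal (u x * c) := by
    rw [← ENNReal.ofReal_mul (by positivity)]
    congr 1
    field_simp
  rw [e]
  refine (mul_le_mul_right hle _).trans (le_of_eq ?_)
  rw [mul_add, ← mul_assoc, ← ENNReal.ofReal_mul (by positivity),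
    ← lintegral_const_mul' (ENNReal.ofReal c⁻¹) _ ENNReal.ofReal_ne_top]
  congr 1
  · congr 2
    field_simp
  · congr 1
    funext t
    rw [← mul_assoc, ← ENNReal.ofReal_mul (by positivity)]
    congr 2
    ring

end KernelAverage

/-! ### Truncated Riesz potentials and absorption -/

/-- The kernel `|z|⁻ᵇ` truncated to the ball of radius `r`. -/
noncomputable def truncatedRiesz {N : ℕ} (b r : ℝ) (z : EuclideanSpace ℝ (Fin N)) : ℝ≥0∞ :=
  (ball 0 r).indicator (fun z => ‖z‖ₑ ^ (-b)) z

/-- The potential of `F` with respect to the truncated Riesz kernel. -/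
noncomputable def truncatedPotential {N : ℕ} (b r : ℝ) (F : EuclideanSpace ℝ (Fin N) → ℝ≥0∞)
    (x : EuclideanSpace ℝ (Fin N)) : ℝ≥0∞ :=
  ∫⁻ y, truncatedRiesz b r (x - y) * F y

theorem ENNReal.rpow_neg_le_rpow_neg {a c : ℝ≥0∞} {b : ℝ} (hb : 0 ≤ b) (h : a ≤ c) :
    c ^ (-b) ≤ a ^ (-b) := by
  rw [ENNReal.rpow_neg, ENNReal.rpow_neg, ENNReal.inv_le_inv]
  exact ENNReal.rpow_le_rpow h hb

section Potential

variable {N : ℕ} {b r : ℝ} {F U V : EuclideanSpace ℝ (Fin N) → ℝ≥0∞}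

@[fun_prop]
theorem measurable_truncatedRiesz (b r : ℝ) :
    Measurable (truncatedRiesz b r : EuclideanSpace ℝ (Fin N) → ℝ≥0∞) := by
  unfold truncatedRiesz
  exact (measurable_enorm.pow_const _).indicator measurableSet_ball

theorem truncatedRiesz_neg (z : EuclideanSpace ℝ (Fin N)) :
    truncatedRiesz b r (-z) = truncatedRiesz b r z := by
  simp [truncatedRiesz, Set.indicator]

theorem truncatedRiesz_sub_comm (x y : EuclideanSpace ℝ (Fin N)) :
    truncatedRiesz b r (x - y) = truncatedRiesz b r (y - x) := by
  rw [← truncatedRiesz_neg, neg_sub]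

/-- The larger length c is at least e / 2, so its negative power is at most 2ᵇ e⁻ᵇ. -/
theorem rpow_enorm_mul_le_of_le {a c e : ℝ≥0∞} (hb : 0 ≤ b) (hc : c ≠ ⊤) (h : e ≤ a + c)
    (hac : a ≤ c) : a ^ (-b) * c ^ (-b) ≤ 2 ^ b * (e ^ (-b) * (a ^ (-b))) := by
  have h1 : e ≤ 2 * c := h.trans (by rw [two_mul]; gcongr)
  have h2 : c ^ (-b) ≤ 2 ^ b * e ^ (-b) := by
    have := ENNReal.rpow_neg_le_rpow_neg hb h1
    rw [ENNReal.mul_rpow_of_ne_top (by simp) hc] at this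
    calc c ^ (-b) = 2 ^ b * (2 ^ (-b) * c ^ (-b)) := by
          rw [← mul_assoc, ← ENNReal.rpow_add _ _ (by simp) (by simp)]; simp
      _ ≤ _ := by gcongr
  calc a ^ (-b) * c ^ (-b) ≤ a ^ (-b) * (2 ^ b * e ^ (-b)) := by gcongr
    _ = _ := by ring

/-- The three-kernel inequality for truncated Riesz kernels. -/
theorem truncatedRiesz_mul_le (hb : 0 ≤ b) (x y z : EuclideanSpace ℝ (Fin N)) :
    truncatedRiesz b r (x - y) * truncatedRiesz b r (y - z) ≤
      2 ^ b * (truncatedRiesz b (2 * r) (x - z) *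
        (truncatedRiesz b r (x - y) + truncatedRiesz b r (y - z))) := by
  by_cases h1 : x - y ∈ ball 0 r
  swap
  · simp [truncatedRiesz, h1]
  by_cases h2 : y - z ∈ ball 0 r
  swap
  · simp [truncatedRiesz, h2]
  have e : x - z = (x - y) + (y - z) := by abel
  have h3 : x - z ∈ ball 0 (2 * r) := by
    rw [mem_ball_zero_iff] at *
    rw [e]
    linarith [norm_add_le (x - y) (y - z)]
  simp only [truncatedRiesz, Set.indicator_of_mem h1, Set.indicator_of_mem h2,
    Set.indicator_of_mem h3]
  have htri : ‖x - z‖ₑ ≤ ‖x - y‖ₑ + ‖y - z‖ₑ := by rw [e]; exact enorm_add_le _ _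
  rcases le_total ‖x - y‖ₑ ‖y - z‖ₑ with h | h
  · refine (rpow_enorm_mul_le_of_le hb enorm_ne_top htri h).trans ?_
    gcongr
    exact le_self_add
  · rw [mul_comm]
    refine (rpow_enorm_mul_le_of_le hb enorm_ne_top (htri.trans (by rw [add_comm])) h).trans ?_
    gcongr
    exact le_add_self

/-- On the annulus r ≤ |z| < 2r the kernel is at most r⁻ᵇ. Thus the radius doubling in the
three-kernel inequality costs only a bounded term when F is integrable. -/
theorem truncatedRiesz_two_mul_le (hb : 0 ≤ b) (hr : 0 < r) (z : EuclideanSpace ℝ (Fin N)) :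
    truncatedRiesz b (2 * r) z ≤ truncatedRiesz b r z + ENNReal.ofReal r ^ (-b) := by
  by_cases h : z ∈ ball 0 r
  · have h2 : z ∈ ball 0 (2 * r) := ball_subset_ball (by linarith) h
    simp [truncatedRiesz, h, h2]
  · by_cases h2 : z ∈ ball 0 (2 * r)
    · simp only [truncatedRiesz, Set.indicator_of_mem h2, Set.indicator_of_notMem h, zero_add]
      refine ENNReal.rpow_neg_le_rpow_neg hb ?_
      rw [← ofReal_norm]
      rw [mem_ball_zero_iff, not_lt] at h
      exact ENNReal.ofReal_le_ofReal h
    · simp [truncatedRiesz, h2]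

theorem truncatedPotential_two_mul_le (hb : 0 ≤ b) (hr : 0 < r) (hF : Measurable F)
    (x : EuclideanSpace ℝ (Fin N)) : truncatedPotential b (2 * r) F x ≤
      truncatedPotential b r F x + ENNReal.ofReal r ^ (-b) * ∫⁻ y, F y := by
  unfold truncatedPotential
  rw [← lintegral_const_mul _ hF, ← lintegral_add_left (by fun_prop)]
  refine lintegral_mono fun y => ?_
  rw [← add_mul]
  gcongr
  exact truncatedRiesz_two_mul_le hb hr _

theorem measurable_truncatedPotential (hF : Measurable F) :
    Measurable (truncatedPotential b r F) := by
  unfold truncatedPotential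
  exact Measurable.lintegral_prod_right' (f := fun p : EuclideanSpace ℝ (Fin N) ×
    EuclideanSpace ℝ (Fin N) => truncatedRiesz b r (p.1 - p.2) * F p.2) (by fun_prop)

theorem ae_truncatedPotential_lt_top (hF : Measurable F) (hF' : ∫⁻ y, F y ≠ ⊤)
    (hk : ∫⁻ z : EuclideanSpace ℝ (Fin N), truncatedRiesz b r z ≠ ⊤) :
    ∀ᵐ x, truncatedPotential b r F x < ⊤ := by
  refine ae_lt_top (measurable_truncatedPotential hF) ?_
  unfold truncatedPotential
  rw [lintegral_lintegral_swap (by fun_prop)]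
  have : ∀ y, ∫⁻ x, truncatedRiesz b r (x - y) * F y =
      (∫⁻ z : EuclideanSpace ℝ (Fin N), truncatedRiesz b r z) * F y := fun y => by
    rw [lintegral_mul_const _ (by fun_prop), lintegral_sub_right_eq_self]
  simp_rw [this]
  rw [lintegral_const_mul _ hF]
  exact ENNReal.mul_ne_top hk hF'

/-- After Tonelli, the three-kernel inequality pulls out the kernel in x - z and leaves the
potentials of V at x and at z, each at most ε. -/
theorem lintegral_truncatedRiesz_mul_potential_le {ε : ℝ≥0∞} (hb : 0 ≤ b) (hF : Measurable F)
    (hV : Measurable V) (hε : ∀ x, truncatedPotential b r V x ≤ ε)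
    (x : EuclideanSpace ℝ (Fin N)) :
    ∫⁻ y, truncatedRiesz b r (x - y) * (V y * truncatedPotential b r F y) ≤
      2 ^ b * (2 * ε) * truncatedPotential b (2 * r) F x := by
  calc ∫⁻ y, truncatedRiesz b r (x - y) * (V y * truncatedPotential b r F y)
      = ∫⁻ y, ∫⁻ z, truncatedRiesz b r (x - y) * (V y * (truncatedRiesz b r (y - z) * F z)) := by
        refine lintegral_congr fun y => ?_
        unfold truncatedPotential
        rw [lintegral_const_mul _ (by fun_prop), lintegral_const_mul _ (by fun_prop)]
    _ = ∫⁻ z, ∫⁻ y, truncatedRiesz b r (x - y) * (V y * (truncatedRiesz b r (y - z) * F z)) :=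
        lintegral_lintegral_swap (by fun_prop)
    _ ≤ ∫⁻ z, 2 ^ b * (2 * ε) * (truncatedRiesz b (2 * r) (x - z) * F z) := by
        refine lintegral_mono fun z => ?_
        calc ∫⁻ y, truncatedRiesz b r (x - y) * (V y * (truncatedRiesz b r (y - z) * F z))
            ≤ ∫⁻ y, (2 ^ b * (truncatedRiesz b (2 * r) (x - z) * F z)) *
                (truncatedRiesz b r (x - y) * V y + truncatedRiesz b r (z - y) * V y) := by
              refine lintegral_mono fun y => ?_
              calc _ = (truncatedRiesz b r (x - y) * truncatedRiesz b r (y - z)) * (V y * F z) := by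
                    ring
                _ ≤ (2 ^ b * (truncatedRiesz b (2 * r) (x - z) *
                    (truncatedRiesz b r (x - y) + truncatedRiesz b r (y - z)))) * (V y * F z) := by
                    exact mul_le_mul_left (truncatedRiesz_mul_le hb x y z) _
                _ = _ := by
                    rw [truncatedRiesz_sub_comm y z]; ring
          _ = (2 ^ b * (truncatedRiesz b (2 * r) (x - z) * F z)) *
                (truncatedPotential b r V x + truncatedPotential b r V z) := by
              rw [lintegral_const_mul _ (by fun_prop), lintegral_add_left (by fun_prop)]
              rfl
          _ ≤ (2 ^ b * (truncatedRiesz b (2 * r) (x - z) * F z)) * (ε + ε) := by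
              gcongr <;> exact hε _
          _ = _ := by ring
    _ = _ := by
        rw [lintegral_const_mul _ (by fun_prop)]
        rfl

/-- If `U` is controlled by the potential of `V * U` with `V` of small potential, then that
potential is bounded. -/
theorem exists_bound_truncatedPotential {ε H C : ℝ≥0∞} {ρ : ℝ} (hb : 0 ≤ b) (hr : 0 < r)
    (hF : Measurable F) (hV : Measurable V) (hF' : ∫⁻ y, F y ≠ ⊤)
    (hk : ∫⁻ z : EuclideanSpace ℝ (Fin N), truncatedRiesz b r z ≠ ⊤)
    (hFU : ∀ y, F y ≤ V y * U y) (hε : ∀ x, truncatedPotential b r V x ≤ ε)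
    (hH : H ≠ ⊤) (hC : C * (2 ^ b * (2 * ε)) ≤ 2⁻¹) (hεt : ε ≠ ⊤)
    (hU : ∀ᵐ y, ‖y‖ < ρ + r → U y ≤ H + C * truncatedPotential b r F y) :
    ∃ M : ℝ≥0∞, M ≠ ⊤ ∧ ∀ᵐ x, ‖x‖ < ρ → truncatedPotential b r F x ≤ M := by
  set a := ENNReal.ofReal r ^ (-b) * ∫⁻ y, F y with ha
  have hat : a ≠ ⊤ := ENNReal.mul_ne_top
    (by rw [ENNReal.ofReal_rpow_of_pos hr]; exact ENNReal.ofReal_ne_top) hF'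
  refine ⟨2 * (H * ε + 2⁻¹ * a), by finiteness, ?_⟩
  filter_upwards [ae_truncatedPotential_lt_top hF hF' hk] with x hx hxρ
  have h1 : truncatedPotential b r F x ≤
      ∫⁻ y, (H * (truncatedRiesz b r (x - y) * V y) +
        C * (truncatedRiesz b r (x - y) * (V y * truncatedPotential b r F y))) := by
    refine lintegral_mono_ae ?_
    filter_upwards [hU] with y hy
    by_cases hxy : x - y ∈ ball 0 r
    · have : ‖y‖ < ρ + r := by
        rw [mem_ball_zero_iff] at hxy
        have : ‖y‖ ≤ ‖x‖ + ‖x - y‖ := by simpa using norm_sub_le x (x - y)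
        linarith
      calc truncatedRiesz b r (x - y) * F y
          ≤ truncatedRiesz b r (x - y) * (V y * (H + C * truncatedPotential b r F y)) := by
            gcongr
            refine (hFU y).trans ?_
            gcongr
            exact hy this
        _ = _ := by ring
    · simp [truncatedRiesz, hxy]
  have hmF := measurable_truncatedPotential (b := b) (r := r) hF
  rw [lintegral_add_left (by fun_prop), lintegral_const_mul _ (by fun_prop),
    lintegral_const_mul _ (by fun_prop)] at h1
  have h2 : truncatedPotential b r F x ≤ H * ε + 2⁻¹ * (truncatedPotential b r F x + a) := by
    refine h1.trans (add_le_add (mul_le_mul_right (hε x) _) ?_)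
    · calc C * ∫⁻ y, truncatedRiesz b r (x - y) * (V y * truncatedPotential b r F y)
          ≤ C * (2 ^ b * (2 * ε) * truncatedPotential b (2 * r) F x) := by
            gcongr
            exact lintegral_truncatedRiesz_mul_potential_le hb hF hV hε x
        _ = C * (2 ^ b * (2 * ε)) * truncatedPotential b (2 * r) F x := by ring
        _ ≤ _ := by
            gcongr
            exact truncatedPotential_two_mul_le hb hr hF x
  generalize truncatedPotential b r F x = J at hx h2
  -- The potential now bounds itself with factor 1/2; subtracting `J` is legitimate because it is
  -- finite almost everywhere.
  have h3 : 2 * J ≤ 2 * (H * ε + 2⁻¹ * a) + J := by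
    calc 2 * J ≤ 2 * (H * ε + 2⁻¹ * (J + a)) := by gcongr
      _ = 2 * (H * ε + 2⁻¹ * a) + (2 * 2⁻¹) * J := by ring
      _ = _ := by rw [ENNReal.mul_inv_cancel (by simp) (by simp), one_mul]
  rw [two_mul J] at h3
  exact (ENNReal.add_le_add_iff_right hx.ne).1 h3

theorem setLIntegral_enorm_rpow_neg_lt_top (hN : 1 ≤ N) {a : ℝ} (ha : a < N) :
    ∫⁻ z in ball (0 : EuclideanSpace ℝ (Fin N)) 1, ‖z‖ₑ ^ (-a) < ⊤ := by
  have : Nonempty (Fin N) := ⟨⟨0, hN⟩⟩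
  have h1 : IntegrableOn (fun z : EuclideanSpace ℝ (Fin N) => ‖z‖ ^ (-a)) (ball 0 1) := by
    refine integrableOn_ball_of_norm_le_rpow (C := 1) (α := a) (by simpa using hN)
      (by simpa using ha) (Filter.Eventually.of_forall fun z => ?_)
      (by fun_prop : Measurable fun z : EuclideanSpace ℝ (Fin N) =>
        ‖z‖ ^ (-a)).aestronglyMeasurable
    rw [one_mul, Real.norm_of_nonneg (by positivity)]
  have h2 := h1.hasFiniteIntegral
  refine lt_of_le_of_lt (lintegral_mono_ae (ae_restrict_of_ae ?_)) h2
  -- The origin is discarded because for a > 0 the real power 0 ^ (-a) is 0 while the extended one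
  -- is ⊤.
  filter_upwards [compl_mem_ae_iff.2 (measure_singleton (0 : EuclideanSpace ℝ (Fin N)))] with z hz
  have hz : 0 < ‖z‖ := norm_pos_iff.2 hz
  rw [Real.enorm_of_nonneg (by positivity), ← ofReal_norm, ENNReal.ofReal_rpow_of_pos hz]

theorem truncatedPotential_le_holder {s s' : ℝ} (hs : s'.HolderConjugate s) (hV : Measurable V)
    (x : EuclideanSpace ℝ (Fin N)) : truncatedPotential b r V x ≤
      (∫⁻ z in ball (0 : EuclideanSpace ℝ (Fin N)) r, ‖z‖ₑ ^ (-(b * s'))) ^ (1 / s') *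
        (∫⁻ y, V y ^ s) ^ (1 / s) := by
  have h := ENNReal.lintegral_mul_le_Lp_mul_Lq volume hs
    (f := fun y => truncatedRiesz b r (x - y)) (g := V)
    (by fun_prop : Measurable fun y => truncatedRiesz b r (x - y)).aemeasurable hV.aemeasurable
  refine h.trans (le_of_eq ?_)
  congr 2
  rw [lintegral_sub_left_eq_self (fun z => truncatedRiesz b r z ^ s') x,
    ← lintegral_indicator measurableSet_ball]
  refine lintegral_congr fun z => ?_
  by_cases hz : z ∈ ball 0 r
  · simp only [truncatedRiesz, Set.indicator_of_mem hz]
    rw [← ENNReal.rpow_mul]; ring_nf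
  · simp only [truncatedRiesz, Set.indicator_of_notMem hz]
    rw [ENNReal.zero_rpow_of_pos hs.pos]

/-- Potentials of `Lˢ` functions over small balls are uniformly small. -/
theorem exists_truncatedPotential_le (hN : 1 ≤ N) {s s' : ℝ} (hs : s'.HolderConjugate s)
    (hbs : b * s' < N) (hV : Measurable V) (hV' : ∫⁻ y, V y ^ s ≠ ⊤) {ε : ℝ≥0∞} (hε : ε ≠ 0)
    {r₀ : ℝ} (hr₀ : 0 < r₀) :
    ∃ r, 0 < r ∧ r ≤ r₀ ∧ ∀ x, truncatedPotential b r V x ≤ ε := by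
  have : Nonempty (Fin N) := ⟨⟨0, hN⟩⟩
  have hlim1 : Filter.Tendsto (fun r : ℝ => volume
      (ball (0 : EuclideanSpace ℝ (Fin N)) r)) (nhdsWithin 0 (Set.Ioi 0)) (nhds 0) := by
    have : Filter.Tendsto (fun r : ℝ => ENNReal.ofReal (r ^ N) *
        volume (ball (0 : EuclideanSpace ℝ (Fin N)) 1)) (nhdsWithin 0 (Set.Ioi 0)) (nhds 0) := by
      have h0 : Filter.Tendsto (fun r : ℝ => ENNReal.ofReal (r ^ N)) (nhdsWithin 0 (Set.Ioi 0))
          (nhds 0) := by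
        have := (ENNReal.continuous_ofReal.comp (continuous_pow N)).tendsto (0 : ℝ)
        simp only [Function.comp_def, zero_pow (by omega : N ≠ 0), ENNReal.ofReal_zero] at this
        exact this.mono_left nhdsWithin_le_nhds
      simpa using ENNReal.Tendsto.mul_const h0 (Or.inr measure_ball_lt_top.ne)
    refine this.congr' ?_
    filter_upwards [self_mem_nhdsWithin] with r hr
    rw [Measure.addHaar_ball volume _ (le_of_lt hr), finrank_euclideanSpace_fin]
  -- Restricting to the unit ball makes the total integral finite, so absolute continuity applies as
  -- the balls shrink.
  have hlim2 : Filter.Tendsto (fun r : ℝ => ∫⁻ z in ball (0 : EuclideanSpace ℝ (Fin N)) r,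
      ‖z‖ₑ ^ (-(b * s')) ∂(volume.restrict (ball 0 1))) (nhdsWithin 0 (Set.Ioi 0)) (nhds 0) :=
    tendsto_setLIntegral_zero (setLIntegral_enorm_rpow_neg_lt_top hN hbs).ne
      (tendsto_of_tendsto_of_tendsto_of_le_of_le tendsto_const_nhds hlim1 (fun _ => zero_le)
        fun r => Measure.restrict_apply_le _ _)
  have hlim3 : Filter.Tendsto (fun r : ℝ => (∫⁻ z in ball (0 : EuclideanSpace ℝ (Fin N)) r,
      ‖z‖ₑ ^ (-(b * s')) ∂(volume.restrict (ball 0 1))) ^ (1 / s') * (∫⁻ y, V y ^ s) ^ (1 / s))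
      (nhdsWithin 0 (Set.Ioi 0)) (nhds 0) := by
    have h1 := hlim2.ennrpow_const (1 / s')
    rw [ENNReal.zero_rpow_of_pos (one_div_pos.2 hs.pos)] at h1
    have h2 := ENNReal.Tendsto.mul_const (b := (∫⁻ y, V y ^ s) ^ (1 / s)) h1
      (Or.inr (ENNReal.rpow_ne_top_of_nonneg (one_div_pos.2 hs.symm.pos).le hV'))
    rwa [zero_mul] at h2
  have hev := (hlim3.eventually (ge_mem_nhds (pos_iff_ne_zero.2 hε))).and
    (Ioc_mem_nhdsGT (lt_min hr₀ one_pos))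
  obtain ⟨r, hr1, hr2⟩ := hev.exists
  refine ⟨r, hr2.1, hr2.2.trans (min_le_left _ _), fun x => ?_⟩
  refine (truncatedPotential_le_holder hs hV x).trans ?_
  rwa [Measure.restrict_restrict_of_subset
    (ball_subset_ball (hr2.2.trans (min_le_right _ _)))] at hr1

end Potential

/-! ### Qualitative local boundedness -/

/-- The source term of the mean value inequality is controlled by a truncated Riesz potential. -/
theorem exists_lintegral_ball_le_truncatedPotential {N : ℕ} (C : ℝ) {b : ℝ} (hb : 0 ≤ b)
    (hbN : (N : ℝ) - 2 < b) : ∃ C' : ℝ≥0∞, C' ≠ ⊤ ∧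
      ∀ (F : EuclideanSpace ℝ (Fin N) → ℝ≥0∞) (x : EuclideanSpace ℝ (Fin N)) (r : ℝ), r ≤ 1 →
        ∫⁻ t in Set.Ioc 0 r, ENNReal.ofReal (C * (t / t ^ N)) * ∫⁻ y in ball x t, F y ≤
          C' * truncatedPotential b r F x := by
  -- The exponent exceeds -1 exactly because b > N - 2.
  have hint : IntegrableOn (fun t : ℝ => C * t ^ (1 - N + b)) (Set.Ioc 0 1) :=
    ((intervalIntegrable_iff_integrableOn_Ioc_of_le zero_le_one).1
      (intervalIntegral.intervalIntegrable_rpow' (by linarith))).const_mul C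
  refine ⟨∫⁻ t in Set.Ioc 0 1, ENNReal.ofReal (C * t ^ (1 - N + b)), ?_, fun F x r hr => ?_⟩
  · refine ne_top_of_le_ne_top hint.hasFiniteIntegral.ne (lintegral_mono fun t => ?_)
    exact Real.ofReal_le_enorm _
  · rw [← lintegral_mul_const _ (by fun_prop)]
    refine le_trans ?_ (lintegral_mono_set (Set.Ioc_subset_Ioc_right hr))
    refine setLIntegral_mono' measurableSet_Ioc fun t ht => ?_
    have ht0 : 0 < t := ht.1
    have h1 : ∫⁻ y in ball x t, F y ≤ ENNReal.ofReal (t ^ b) * truncatedPotential b r F x := by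
      unfold truncatedPotential
      rw [← lintegral_indicator measurableSet_ball, ← lintegral_const_mul' _ _ ENNReal.ofReal_ne_top]
      refine lintegral_mono fun y => ?_
      by_cases hy : y ∈ ball x t
      · have hxy : ‖x - y‖ < t := by rwa [mem_ball', dist_eq_norm] at hy
        rw [Set.indicator_of_mem hy, truncatedRiesz,
          Set.indicator_of_mem (mem_ball_zero_iff.2 (hxy.trans_le ht.2)), ← mul_assoc]
        refine le_mul_of_one_le_left (zero_le) ?_
        have h2 : ENNReal.ofReal t ^ (-b) ≤ ‖x - y‖ₑ ^ (-b) := by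
          refine ENNReal.rpow_neg_le_rpow_neg hb ?_
          rw [← ofReal_norm]
          exact ENNReal.ofReal_le_ofReal hxy.le
        calc (1 : ℝ≥0∞) = ENNReal.ofReal (t ^ b) * ENNReal.ofReal t ^ (-b) := by
              rw [← ENNReal.ofReal_rpow_of_pos ht0, ← ENNReal.rpow_add _ _ (by simpa using ht0)
                ENNReal.ofReal_ne_top]
              simp
          _ ≤ _ := by gcongr
      · simp [hy]
    calc _ ≤ ENNReal.ofReal (C * (t / t ^ N)) *
          (ENNReal.ofReal (t ^ b) * truncatedPotential b r F x) := by gcongr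
      _ = _ := by
        rw [← mul_assoc, ← ENNReal.ofReal_mul' (by positivity)]
        congr 2
        rw [Real.rpow_add ht0, Real.rpow_sub ht0, Real.rpow_one, Real.rpow_natCast]
        ring

/-- Take s = q / (p - 2), or s = N if p = 2. Subcriticality gives s > N/2, so N - 2 < N - N/s =
N/s', and b is the midpoint of this window. -/
theorem exists_exponents {N : ℕ} {p q : ℝ} (hN : 2 ≤ N) (hp : 2 ≤ p) (hq : 1 ≤ q)
    (hpq : (p - 2) / 2 * (N : ℝ) < q) : ∃ s s' b : ℝ, s'.HolderConjugate s ∧ 0 ≤ b ∧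
      (N : ℝ) - 2 < b ∧ b < N ∧ b * s' < N ∧ (p - 2) * s ≤ q := by
  have hN' : (2 : ℝ) ≤ N := by exact_mod_cast hN
  obtain ⟨s, hs1, hsN, hsq⟩ : ∃ s : ℝ, 1 < s ∧ (N : ℝ) / 2 < s ∧ (p - 2) * s ≤ q := by
    rcases hp.eq_or_lt with rfl | hp2
    · exact ⟨N, by linarith, by linarith, by linarith⟩
    · have h0 : 0 < p - 2 := by linarith
      have h1 : (N : ℝ) / 2 < q / (p - 2) := by
        rw [lt_div_iff₀ h0]; linarith
      exact ⟨q / (p - 2), by linarith, h1, by rw [mul_div_cancel₀ _ h0.ne']⟩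
  have hs := (Real.HolderConjugate.conjExponent hs1).symm
  have hs0 : 0 < s := by linarith
  have h1 : (N : ℝ) / s < 2 := by rw [div_lt_iff₀ hs0]; linarith
  have h2 : (0 : ℝ) < N / s := by positivity
  refine ⟨s, s.conjExponent, (N - 2 + (N - N / s)) / 2, hs, by linarith, by linarith, by linarith,
    ?_, hsq⟩
  have h3 : (N : ℝ) = (N - N / s) * s.conjExponent := by
    have : s - 1 ≠ 0 := by linarith
    rw [Real.conjExponent]; field_simp
  nth_rewrite 4 [h3]
  exact mul_lt_mul_of_pos_right (by linarith) hs.pos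

/-- The absorption radius, hence the bound, depends on u through the Lˢ function u^(p-2). -/
theorem IsNonnegSubsolution.exists_ae_le_of_norm_lt {N : ℕ} {p q R R₁ : ℝ} (hN : 1 ≤ N)
    (hp : 2 ≤ p) (hq : 1 ≤ q) (hpq : (p - 2) / 2 * (N : ℝ) < q)
    {u : EuclideanSpace ℝ (Fin N) → ℝ} (hu : Measurable u)
    (h : IsNonnegSubsolution R u (fun x => u x ^ (p - 1)))
    (hu0 : ∀ x, x ∉ ball 0 R → u x = 0)
    (huq : ∫⁻ x, ENNReal.ofReal (u x ^ q) ≠ ⊤) (hR : R₁ < R) :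
    ∃ M : ℝ, ∀ᵐ x, ‖x‖ < R₁ → u x ≤ M := by
  obtain ⟨C, hC, hmean⟩ := exists_mean_value_inequality N hN
  have hmean := hmean R u _ h
  have hIU : ∫⁻ y, ENNReal.ofReal (u y) ≠ ⊤ :=
    ne_top_of_le_ne_top h.integrable.hasFiniteIntegral.ne
      (lintegral_mono fun y => Real.ofReal_le_enorm _)
  have hIF : ∫⁻ y, ENNReal.ofReal (u y ^ (p - 1)) ≠ ⊤ :=
    ne_top_of_le_ne_top h.integrable_source.hasFiniteIntegral.ne
      (lintegral_mono fun y => Real.ofReal_le_enorm _)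
  set F : EuclideanSpace ℝ (Fin N) → ℝ≥0∞ := fun y => ENNReal.ofReal (u y ^ (p - 1)) with hF
  have hFm : Measurable F := by fun_prop
  suffices ∃ M : ℝ≥0∞, M ≠ ⊤ ∧ ∀ᵐ x, ‖x‖ < R₁ → ENNReal.ofReal (u x) ≤ M by
    obtain ⟨M, hM, hM'⟩ := this
    refine ⟨M.toReal, ?_⟩
    filter_upwards [hM'] with x hx hxR
    exact (ENNReal.ofReal_le_iff_le_toReal hM).1 (hx hxR)
  -- Radius at most 1 allows the Riesz comparison; the other limit ensures that ‖x‖ < R₁ + r implies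
  -- ‖x‖ + r < R.
  set r₀ := min 1 ((R - R₁) / 2) with hr₀
  have hr₀' : 0 < r₀ := lt_min one_pos (by linarith)
  have hpot : ∀ b : ℝ, 0 ≤ b → (N : ℝ) - 2 < b → ∃ C' : ℝ≥0∞, C' ≠ ⊤ ∧ ∀ r, 0 < r → r ≤ r₀ →
      ∃ H : ℝ≥0∞, H ≠ ⊤ ∧ ∀ᵐ x, ‖x‖ < R₁ + r →
        ENNReal.ofReal (u x) ≤ H + C' * truncatedPotential b r F x := by
    intro b hb hbN
    obtain ⟨C', hC', hC''⟩ := exists_lintegral_ball_le_truncatedPotential C hb hbN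
    refine ⟨C', hC', fun r hr hrr => ⟨ENNReal.ofReal (C / r ^ N) * ∫⁻ y, ENNReal.ofReal (u y),
      by finiteness, ?_⟩⟩
    filter_upwards [hmean] with x hx hxR
    have h2 : r ≤ (R - R₁) / 2 := hrr.trans (min_le_right _ _)
    refine (hx r hr (by linarith)).trans (add_le_add ?_ (hC'' F x r (hrr.trans (min_le_left _ _))))
    gcongr
    exact Measure.restrict_le_self
  rcases hN.eq_or_lt with rfl | hN2
  -- In dimension one b = 0 is allowed: the kernel is at most 1 and no absorption is needed.
  · obtain ⟨C', hC', hC''⟩ := hpot 0 le_rfl (by norm_num)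
    obtain ⟨H, hH, hH'⟩ := hC'' r₀ hr₀' le_rfl
    refine ⟨H + C' * ∫⁻ y, F y, by finiteness, ?_⟩
    filter_upwards [hH'] with x hx hxR
    refine (hx (by linarith)).trans ?_
    gcongr
    refine lintegral_mono fun y => ?_
    refine mul_le_of_le_one_left zero_le ?_
    by_cases hxy : x - y ∈ ball 0 r₀ <;> simp [truncatedRiesz, hxy]
  · obtain ⟨s, s', b, hs, hb, hbN, hbN', hbs, hsq⟩ := exists_exponents hN2 hp hq hpq
    obtain ⟨C', hC', hC''⟩ := hpot b hb hbN
    -- The indicator matters for p = 2, where u ^ 0 = 1 also outside the ball.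
    set V : EuclideanSpace ℝ (Fin N) → ℝ≥0∞ :=
      (ball 0 R).indicator fun x => ENNReal.ofReal (u x ^ (p - 2)) with hV
    have hVm : Measurable V := Measurable.indicator (by fun_prop) measurableSet_ball
    have hVs : ∫⁻ y, V y ^ s ≠ ⊤ := by
      have hfin : ∫⁻ y in ball (0 : EuclideanSpace ℝ (Fin N)) R,
          (1 + ENNReal.ofReal (u y ^ q)) ≠ ⊤ := by
        rw [lintegral_add_left measurable_const]
        refine ENNReal.add_ne_top.2 ⟨?_, ?_⟩
        · simpa using measure_ball_lt_top.ne
        · exact ne_top_of_le_ne_top huq (setLIntegral_le_lintegral _ _)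
      refine ne_top_of_le_ne_top hfin ?_
      rw [← lintegral_indicator measurableSet_ball]
      refine lintegral_mono fun y => ?_
      by_cases hy : y ∈ ball 0 R
      · simp only [hV, Set.indicator_of_mem hy]
        rw [ENNReal.ofReal_rpow_of_nonneg (Real.rpow_nonneg (h.nonneg y) _) hs.symm.pos.le,
          ← Real.rpow_mul (h.nonneg y), ← ENNReal.ofReal_one,
          ← ENNReal.ofReal_add zero_le_one (Real.rpow_nonneg (h.nonneg y) _)]
        refine ENNReal.ofReal_le_ofReal ?_
        have h0 : 0 ≤ (p - 2) * s := mul_nonneg (by linarith) hs.symm.pos.le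
        have h1 := Real.rpow_nonneg (h.nonneg y) q
        rcases le_total (u y) 1 with h2 | h2
        · linarith [Real.rpow_le_one (h.nonneg y) h2 h0]
        · linarith [Real.rpow_le_rpow_of_exponent_le h2 hsq]
      · simp only [hV, Set.indicator_of_notMem hy]
        rw [ENNReal.zero_rpow_of_pos hs.symm.pos]
    have hFU : ∀ y, F y ≤ V y * ENNReal.ofReal (u y) := by
      intro y
      rcases (h.nonneg y).eq_or_lt with h0 | h0
      · simp [hF, ← h0, Real.zero_rpow (by linarith : p - 1 ≠ 0)]
      · have hy : y ∈ ball 0 R := by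
          by_contra hy
          exact h0.ne' (hu0 y hy)
        simp only [hV, hF, Set.indicator_of_mem hy]
        rw [← ENNReal.ofReal_mul (Real.rpow_nonneg (h.nonneg y) _)]
        refine le_of_eq ?_
        congr 1
        rw [show p - 1 = p - 2 + 1 by ring, Real.rpow_add h0, Real.rpow_one]
    set K := C' * (2 ^ b * 2) with hK
    have hKt : K ≠ ⊤ := ENNReal.mul_ne_top hC'
      (ENNReal.mul_ne_top (ENNReal.rpow_ne_top_of_nonneg hb (by simp)) (by simp))
    -- Chosen so that K ε ≤ 1/2; the added 1 keeps ε finite when K = 0.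
    set ε : ℝ≥0∞ := (2 * (K + 1))⁻¹ with hε
    have hε0 : ε ≠ 0 := ENNReal.inv_ne_zero.2 (by finiteness)
    have hεt : ε ≠ ⊤ := ENNReal.inv_ne_top.2 (by simp)
    have hKε : C' * (2 ^ b * (2 * ε)) ≤ 2⁻¹ := by
      calc C' * (2 ^ b * (2 * ε)) = K * ε := by rw [hK]; ring
        _ = 2⁻¹ * (K * (K + 1)⁻¹) := by
          rw [hε, ENNReal.mul_inv (by simp) (by simp)]; ring
        _ ≤ 2⁻¹ * 1 := by
          gcongr
          rw [← div_eq_mul_inv]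
          exact ENNReal.div_le_of_le_mul (by rw [one_mul]; exact le_self_add)
        _ = 2⁻¹ := mul_one _
    obtain ⟨r, hr, hrr, hpV⟩ := exists_truncatedPotential_le hN hs hbs hVm hVs hε0 hr₀'
    obtain ⟨H, hH, hH'⟩ := hC'' r hr hrr
    have hk : ∫⁻ z : EuclideanSpace ℝ (Fin N), truncatedRiesz b r z ≠ ⊤ := by
      unfold truncatedRiesz
      rw [lintegral_indicator measurableSet_ball]
      exact ne_top_of_le_ne_top (setLIntegral_enorm_rpow_neg_lt_top hN hbN').ne
        (lintegral_mono_set (ball_subset_ball (hrr.trans (min_le_left _ _))))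
    obtain ⟨M, hM, hM'⟩ := exists_bound_truncatedPotential (ρ := R₁) hb hr hFm hVm hIF hk hFU hpV hH
      hKε hεt hH'
    refine ⟨H + C' * M, by finiteness, ?_⟩
    filter_upwards [hH', hM'] with x h1 h2 hx
    refine (h1 (by linarith)).trans ?_
    gcongr
    exact h2 hx

/-! ### Point-picking and quantitative smallness -/

theorem le_add_rpow_mul_rpow {a l q : ℝ} (ha : 0 ≤ a) (hl : 0 < l) (hq : 1 ≤ q) :
    a ≤ l + l ^ (1 - q) * a ^ q := by
  rcases le_total a l with h | h
  · have := mul_nonneg (Real.rpow_nonneg hl.le (1 - q)) (Real.rpow_nonneg ha q)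
    linarith
  · have ha' : 0 < a := hl.trans_le h
    have h1 : a ^ (1 - q) ≤ l ^ (1 - q) := Real.rpow_le_rpow_of_nonpos hl h (by linarith)
    have h2 : a = a ^ (1 - q) * a ^ q := by
      rw [← Real.rpow_add ha']; simp
    have h3 := mul_le_mul_of_nonneg_right h1 (Real.rpow_nonneg ha q)
    linarith

/-- Consequence of the mean value inequality at a point where `u` is comparable to its supremum
over a ball. -/
theorem rpow_mul_pow_le_of_mean_value {N : ℕ} {p q C L r δ : ℝ} (hp : 2 ≤ p) (hq : 1 ≤ q)
    (hC : 0 < C) (hr : 0 < r) (hL : 0 < L) (hδ : 0 ≤ δ) {u : EuclideanSpace ℝ (Fin N) → ℝ}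
    (hu : Measurable u) (hu0 : ∀ y, 0 ≤ u y) {x : EuclideanSpace ℝ (Fin N)} (hx : 0 < u x)
    (hbd : ∀ᵐ y, y ∈ ball x r → u y ≤ L * u x)
    (hδ' : ∫⁻ y, ENNReal.ofReal (u y ^ q) ≤ ENNReal.ofReal δ)
    (hmean : ENNReal.ofReal (u x) ≤
        ENNReal.ofReal (C / r ^ N) * (∫⁻ y in ball x r, ENNReal.ofReal (u y)) +
          ∫⁻ t in Set.Ioc 0 r, ENNReal.ofReal (C * (t / t ^ N)) *
            ∫⁻ y in ball x t, ENNReal.ofReal (u y ^ (p - 1)))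
    (hsmall : C * volume.real (ball (0 : EuclideanSpace ℝ (Fin N)) 1) * L ^ (p - 1) *
      u x ^ (p - 2) * r ^ 2 ≤ 1 / 4) :
    u x ^ q * r ^ N ≤
      2 * C * (4 * C * volume.real (ball (0 : EuclideanSpace ℝ (Fin N)) 1)) ^ (q - 1) * δ := by
  set v := volume.real (ball (0 : EuclideanSpace ℝ (Fin N)) 1)
  have hv : 0 < v := ENNReal.toReal_pos (measure_ball_pos _ _ one_pos).ne' measure_ball_lt_top.ne
  have hvol : ∀ t, 0 < t → volume (ball x t) = ENNReal.ofReal (t ^ N * v) := fun t ht => by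
    rw [Measure.addHaar_ball_of_pos volume _ ht, finrank_euclideanSpace_fin,
      ENNReal.ofReal_mul (by positivity)]
    congr 1
    exact (ENNReal.ofReal_toReal measure_ball_lt_top.ne).symm
  set M := u x
  -- With this truncation level the part of u below l contributes exactly M / 4 to the mean value
  -- bound.
  set l := M / (4 * C * v) with hl
  have hl0 : 0 < l := by positivity
  have h1 : ENNReal.ofReal (C / r ^ N) * (∫⁻ y in ball x r, ENNReal.ofReal (u y)) ≤
      ENNReal.ofReal (M / 4 + C / r ^ N * (l ^ (1 - q) * δ)) := by
    have : ∫⁻ y in ball x r, ENNReal.ofReal (u y) ≤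
        ENNReal.ofReal (l * (r ^ N * v) + l ^ (1 - q) * δ) := by
      calc ∫⁻ y in ball x r, ENNReal.ofReal (u y)
          ≤ ∫⁻ y in ball x r, (ENNReal.ofReal l +
              ENNReal.ofReal (l ^ (1 - q)) * ENNReal.ofReal (u y ^ q)) := by
            refine lintegral_mono fun y => ?_
            rw [← ENNReal.ofReal_mul (by positivity), ← ENNReal.ofReal_add hl0.le
              (mul_nonneg (by positivity) (Real.rpow_nonneg (hu0 y) _))]
            exact ENNReal.ofReal_le_ofReal (le_add_rpow_mul_rpow (hu0 y) hl0 hq)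
        _ = ENNReal.ofReal l * ENNReal.ofReal (r ^ N * v) + ENNReal.ofReal (l ^ (1 - q)) *
              ∫⁻ y in ball x r, ENNReal.ofReal (u y ^ q) := by
            rw [lintegral_add_left measurable_const, setLIntegral_const, hvol r hr,
              lintegral_const_mul _ (by fun_prop)]
        _ ≤ ENNReal.ofReal l * ENNReal.ofReal (r ^ N * v) + ENNReal.ofReal (l ^ (1 - q)) *
              ENNReal.ofReal δ := by
            gcongr
            exact (setLIntegral_le_lintegral _ _).trans hδ'
        _ = _ := by
            rw [← ENNReal.ofReal_mul hl0.le, ← ENNReal.ofReal_mul (by positivity),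
              ← ENNReal.ofReal_add (by positivity) (by positivity)]
    calc _ ≤ ENNReal.ofReal (C / r ^ N) * ENNReal.ofReal (l * (r ^ N * v) + l ^ (1 - q) * δ) := by
          gcongr
      _ = _ := by
          rw [← ENNReal.ofReal_mul (by positivity)]
          congr 1
          rw [mul_add]
          congr 1
          rw [hl]
          field_simp
  -- The volume tᴺ v cancels t⁻ᴺ; bounding the remaining t by r and integrating gives r², which
  -- `hsmall` controls.
  have h2 : ∫⁻ t in Set.Ioc 0 r, ENNReal.ofReal (C * (t / t ^ N)) *
      (∫⁻ y in ball x t, ENNReal.ofReal (u y ^ (p - 1))) ≤ ENNReal.ofReal (M / 4) := by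
    calc _ ≤ ∫⁻ t in Set.Ioc 0 r, ENNReal.ofReal (C * r * v * (L * M) ^ (p - 1)) := by
          refine setLIntegral_mono' measurableSet_Ioc fun t ht => ?_
          have ht0 : 0 < t := ht.1
          have : ∫⁻ y in ball x t, ENNReal.ofReal (u y ^ (p - 1)) ≤
              ENNReal.ofReal ((L * M) ^ (p - 1)) * ENNReal.ofReal (t ^ N * v) := by
            rw [← hvol t ht0, ← setLIntegral_const]
            refine setLIntegral_mono_ae measurable_const.aemeasurable ?_
            filter_upwards [hbd] with y hy hyt
            refine ENNReal.ofReal_le_ofReal (Real.rpow_le_rpow (hu0 y)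
              (hy (ball_subset_ball ht.2 hyt)) (by linarith))
          calc _ ≤ ENNReal.ofReal (C * (t / t ^ N)) *
                (ENNReal.ofReal ((L * M) ^ (p - 1)) * ENNReal.ofReal (t ^ N * v)) := by gcongr
            _ = ENNReal.ofReal (C * t * v * (L * M) ^ (p - 1)) := by
                rw [← ENNReal.ofReal_mul (by positivity), ← ENNReal.ofReal_mul (by positivity)]
                congr 1
                field_simp
            _ ≤ _ := by
                gcongr
                exact ht.2
      _ = ENNReal.ofReal ((C * v * L ^ (p - 1) * M ^ (p - 2) * r ^ 2) * M) := by
          rw [setLIntegral_const, Real.volume_Ioc, ← ENNReal.ofReal_mul (by positivity)]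
          congr 1
          have : M ^ (p - 1) = M ^ (p - 2) * M := by
            rw [show p - 1 = p - 2 + 1 by ring, Real.rpow_add hx, Real.rpow_one]
          rw [Real.mul_rpow hL.le hx.le, this]
          ring
      _ ≤ _ := by
          refine ENNReal.ofReal_le_ofReal ?_
          have := mul_le_mul_of_nonneg_right hsmall hx.le
          linarith
  have h3 := hmean.trans (add_le_add h1 h2)
  rw [← ENNReal.ofReal_add (by positivity) (by positivity),
    ENNReal.ofReal_le_ofReal_iff (by positivity)] at h3
  have h4 : M / 2 ≤ C / r ^ N * (l ^ (1 - q) * δ) := by linarith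
  have h5 : l ^ (1 - q) = M ^ (1 - q) * (4 * C * v) ^ (q - 1) := by
    rw [hl, Real.div_rpow hx.le (by positivity), div_eq_mul_inv,
      ← Real.rpow_neg (by positivity), neg_sub]
  have h6 : M ^ q = M ^ (q - 1) * M := by
    rw [← Real.rpow_add_one hx.ne']; ring_nf
  have h7 : M ^ (q - 1) * M ^ (1 - q) = 1 := by
    rw [← Real.rpow_add hx]; simp
  calc M ^ q * r ^ N = 2 * M ^ (q - 1) * r ^ N * (M / 2) := by rw [h6]; ring
    _ ≤ 2 * M ^ (q - 1) * r ^ N * (C / r ^ N * (l ^ (1 - q) * δ)) := by gcongr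
    _ = 2 * C * (4 * C * v) ^ (q - 1) * δ * (M ^ (q - 1) * M ^ (1 - q)) := by
        rw [h5]; field_simp
    _ = _ := by rw [h7, mul_one]

/-- The smallness statement for globally defined nonnegative subsolutions of `-Δ u ≤ u ^ (p - 1)`. -/
theorem IsNonnegSubsolution.exists_smallness (N : ℕ) (hN : 1 ≤ N) (p q : ℝ) (hp : 2 ≤ p)
    (hq : 1 ≤ q) (hpq : (p - 2) / 2 * (N : ℝ) < q) (η ρ R : ℝ) (hη : 0 < η) (hρ : 0 < ρ)
    (hρR : ρ < R) : ∃ δ : ℝ, 0 < δ ∧ ∀ u : EuclideanSpace ℝ (Fin N) → ℝ, Measurable u →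
      IsNonnegSubsolution R u (fun x => u x ^ (p - 1)) → (∀ x, x ∉ ball 0 R → u x = 0) →
        ∫⁻ x, ENNReal.ofReal (u x ^ q) ≤ ENNReal.ofReal δ →
          ∀ᵐ x, ‖x‖ < ρ → u x ≤ η := by
  obtain ⟨C, hC, hmean⟩ := exists_mean_value_inequality N hN
  set v := volume.real (ball (0 : EuclideanSpace ℝ (Fin N)) 1) with hv_def
  have hv : 0 < v := ENNReal.toReal_pos (measure_ball_pos _ _ one_pos).ne' measure_ball_lt_top.ne
  obtain ⟨R₁, hρR₁, hR₁R⟩ := exists_between hρR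
  have hR₁ : 0 < R₁ := hρ.trans hρR₁
  have hq0 : 0 < q := by linarith
  -- This exponent gives (d^α u)^q = dᴺ u^q, the quantity controlled by the mean value inequality.
  set α : ℝ := N / q with hα
  have hα0 : 0 ≤ α := by positivity
  -- One factor 2 is for near-maximality, 2^α for halving the distance in the weight.
  set L : ℝ := 2 * 2 ^ α with hL_def
  have hL : 0 < L := by positivity
  set A := C * v * L ^ (p - 1) with hA_def
  have hA : 0 < A := by positivity
  set K := 2 * C * (4 * C * v) ^ (q - 1) with hK_def
  have hK : 0 < K := by positivity
  set c := Real.sqrt (1 / (4 * A)) with hc_def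
  have hc : 0 < c := Real.sqrt_pos.2 (by positivity)
  set σ := η * (R₁ - ρ) ^ α with hσ_def
  have hσ : 0 < σ := mul_pos hη (Real.rpow_pos_of_pos (by linarith) _)
  set κ := q - (p - 2) / 2 * N with hκ_def
  have hκ : 0 < κ := by linarith
  -- Lower bound for u at any point where the weighted value exceeds σ / 2.
  set m := σ / (2 * R₁ ^ α) with hm_def
  have hm : 0 < m := by positivity
  -- One entry contradicts each possible choice of r; the 2 in the second makes `hδ2` strict.
  refine ⟨min ((σ / 2) ^ q / (2 ^ N * K)) (c ^ N * m ^ κ / (2 * K)),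
    lt_min (by positivity) (by positivity), fun u hu h hu0 hδ => ?_⟩
  set δ := min ((σ / 2) ^ q / (2 ^ N * K)) (c ^ N * m ^ κ / (2 * K)) with hδ_def
  have hδ0 : 0 < δ := lt_min (by positivity) (by positivity)
  have hδ1 : 2 ^ N * (K * δ) ≤ (σ / 2) ^ q := by
    have := min_le_left ((σ / 2) ^ q / (2 ^ N * K)) (c ^ N * m ^ κ / (2 * K))
    rw [← hδ_def, le_div_iff₀ (by positivity)] at this
    linarith
  have hδ2 : K * δ < c ^ N * m ^ κ := by
    have := min_le_right ((σ / 2) ^ q / (2 ^ N * K)) (c ^ N * m ^ κ / (2 * K))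
    rw [← hδ_def, le_div_iff₀ (by positivity)] at this
    have : 0 < K * δ := by positivity
    linarith
  obtain ⟨M₀, hM₀⟩ := h.exists_ae_le_of_norm_lt hN hp hq hpq hu hu0
    (ne_top_of_le_ne_top ENNReal.ofReal_ne_top hδ) hR₁R
  -- Points where the almost-everywhere statements hold, so that a genuine supremum over `G` can be
  -- used.
  set G : Set (EuclideanSpace ℝ (Fin N)) := {x | ‖x‖ < R₁ ∧ u x ≤ M₀ ∧
    ∀ r, 0 < r → ‖x‖ + r < R → ENNReal.ofReal (u x) ≤
        ENNReal.ofReal (C / r ^ N) * (∫⁻ y in ball x r, ENNReal.ofReal (u y)) +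
          ∫⁻ t in Set.Ioc 0 r, ENNReal.ofReal (C * (t / t ^ N)) *
            ∫⁻ y in ball x t, ENNReal.ofReal (u y ^ (p - 1))} with hG
  have hGae : ∀ᵐ x, ‖x‖ < R₁ → x ∈ G := by
    filter_upwards [hM₀, hmean R u _ h] with x h1 h2 hx
    exact ⟨hx, h1 hx, h2⟩
  set Q : EuclideanSpace ℝ (Fin N) → ℝ := fun x => (R₁ - ‖x‖) ^ α * u x with hQ
  have hbdd : BddAbove (Q '' G) := by
    refine ⟨R₁ ^ α * M₀, ?_⟩
    rintro _ ⟨x, hx, rfl⟩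
    have h1 : 0 < R₁ - ‖x‖ := by linarith [hx.1]
    have h2 : R₁ - ‖x‖ ≤ R₁ := by linarith [norm_nonneg x]
    exact mul_le_mul (Real.rpow_le_rpow h1.le h2 hα0) hx.2.1 (h.nonneg x) (by positivity)
  suffices hS : ∀ x ∈ G, Q x ≤ σ by
    filter_upwards [hGae] with x hx hxρ
    have h1 := hS x (hx (hxρ.trans hρR₁))
    have h2 : (R₁ - ρ) ^ α * u x ≤ Q x :=
      mul_le_mul_of_nonneg_right (Real.rpow_le_rpow (by linarith) (by linarith) hα0) (h.nonneg x)
    have h3 : 0 < (R₁ - ρ) ^ α := Real.rpow_pos_of_pos (by linarith) _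
    rw [hσ_def, mul_comm η] at h1
    exact le_of_mul_le_mul_left (h2.trans h1) h3
  by_contra! hcon
  obtain ⟨x₁, hx₁, hσx⟩ := hcon
  set S := sSup (Q '' G) with hS_def
  have hSσ : σ < S := hσx.trans_le (le_csSup hbdd ⟨x₁, hx₁, rfl⟩)
  obtain ⟨_, ⟨x, hx, rfl⟩, hxS⟩ := exists_lt_of_lt_csSup (Set.Nonempty.image Q ⟨x₁, hx₁⟩)
    (show S / 2 < S by linarith)
  set d := R₁ - ‖x‖ with hd_def
  have hd : 0 < d := by linarith [hx.1]
  have hQx : Q x = d ^ α * u x := rfl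
  rw [hQx] at hxS
  have hdα : 0 < d ^ α := Real.rpow_pos_of_pos hd _
  have hM : 0 < u x := by
    refine pos_of_mul_pos_right (b := u x) (a := d ^ α) ?_ hdα.le
    linarith
  -- The first limit keeps the weight comparable on the ball; the second makes the source term at
  -- most u x / 4.
  set r := min (d / 2) (c * u x ^ (-((p - 2) / 2))) with hr_def
  have hr : 0 < r := lt_min (by positivity) (by positivity)
  have hrd : r ≤ d / 2 := min_le_left _ _
  have hbd : ∀ᵐ y, y ∈ ball x r → u y ≤ L * u x := by
    filter_upwards [hGae] with y hy hyx
    have h1 : ‖y‖ ≤ ‖y - x‖ + ‖x‖ := by simpa using norm_add_le (y - x) x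
    rw [mem_ball, dist_eq_norm] at hyx
    have h2 : d / 2 < R₁ - ‖y‖ := by linarith
    have h3 := le_csSup hbdd ⟨y, hy (by linarith), rfl⟩
    rw [← hS_def] at h3
    have h4 : (d / 2) ^ α * u y ≤ Q y :=
      mul_le_mul_of_nonneg_right (Real.rpow_le_rpow (by positivity) h2.le hα0) (h.nonneg y)
    have h5 : (d / 2) ^ α = d ^ α / 2 ^ α := Real.div_rpow hd.le (by norm_num) _
    have h6 : d ^ α / 2 ^ α * u y ≤ 2 * (d ^ α * u x) := by rw [← h5]; linarith
    have h7 : d ^ α / 2 ^ α * u y ≤ d ^ α / 2 ^ α * (L * u x) := by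
      refine h6.trans (le_of_eq ?_)
      rw [hL_def]; field_simp
    exact le_of_mul_le_mul_left h7 (by positivity)
  have hpow : ∀ n : ℕ, (u x ^ (-((p - 2) / 2))) ^ n = u x ^ (-((p - 2) / 2 * n)) := fun n => by
    rw [← Real.rpow_natCast, ← Real.rpow_mul hM.le]; ring_nf
  have hsmall : A * u x ^ (p - 2) * r ^ 2 ≤ 1 / 4 := by
    have h1 : r ^ 2 ≤ c ^ 2 * u x ^ (-(p - 2)) := by
      calc r ^ 2 ≤ (c * u x ^ (-((p - 2) / 2))) ^ 2 :=
            pow_le_pow_left₀ hr.le (min_le_right _ _) 2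
        _ = _ := by
            rw [mul_pow, hpow]
            congr 2
            push_cast; ring
    calc A * u x ^ (p - 2) * r ^ 2 ≤ A * u x ^ (p - 2) * (c ^ 2 * u x ^ (-(p - 2))) := by gcongr
      _ = A * c ^ 2 * (u x ^ (p - 2) * u x ^ (-(p - 2))) := by ring
      _ = 1 / 4 := by
          rw [← Real.rpow_add hM, hc_def, Real.sq_sqrt (by positivity)]
          simp only [add_neg_cancel, Real.rpow_zero]
          field_simp
  have key := rpow_mul_pow_le_of_mean_value hp hq hC hr hL hδ0.le hu h.nonneg hM hbd hδ
    (hx.2.2 r hr (by linarith)) hsmall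
  rcases le_total (d / 2) (c * u x ^ (-((p - 2) / 2))) with hcase | hcase
  · have hrv : r = d / 2 := min_eq_left hcase
    rw [hrv] at key
    have h1 : (d ^ α * u x) ^ q = u x ^ q * d ^ N := by
      rw [Real.mul_rpow hdα.le hM.le, ← Real.rpow_mul hd.le, hα, div_mul_cancel₀ _ hq0.ne',
        Real.rpow_natCast, mul_comm]
    have h2 : (σ / 2) ^ q < (d ^ α * u x) ^ q :=
      Real.rpow_lt_rpow (by positivity) (by linarith) hq0
    have h3 : u x ^ q * d ^ N = 2 ^ N * (u x ^ q * (d / 2) ^ N) := by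
      rw [div_pow]; field_simp
    rw [h1, h3] at h2
    have h4 : 2 ^ N * (u x ^ q * (d / 2) ^ N) ≤ 2 ^ N * (K * δ) := by gcongr
    linarith
  · have hrv : r = c * u x ^ (-((p - 2) / 2)) := min_eq_right hcase
    rw [hrv, mul_pow, hpow] at key
    -- Subcriticality enters here: the surviving exponent κ is positive, so u x ≥ m contradicts the
    -- choice of δ.
    have h1 : u x ^ q * (c ^ N * u x ^ (-((p - 2) / 2 * N))) = c ^ N * u x ^ κ := by
      rw [show κ = q + -((p - 2) / 2 * N) by ring, Real.rpow_add hM]; ring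
    rw [h1] at key
    have h2 : m ≤ u x := by
      rw [hm_def, div_le_iff₀ (by positivity)]
      have : d ^ α ≤ R₁ ^ α := Real.rpow_le_rpow hd.le (by linarith [norm_nonneg x]) hα0
      have := mul_le_mul_of_nonneg_right this hM.le
      linarith
    have h3 : c ^ N * m ^ κ ≤ c ^ N * u x ^ κ := by gcongr
    linarith

/-! ### Passage to an everywhere defined representative -/

/-- A nonnegative distributional subsolution in a ball agrees there with a measurable one that is
defined everywhere and vanishes outside the ball. -/
theorem exists_isNonnegSubsolution {N : ℕ} {p R : ℝ} (hp : 2 ≤ p)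
    {w : EuclideanSpace ℝ (Fin N) → ℝ}
    (hw : MemLp w (ENNReal.ofReal (p - 1)) (volume.restrict (ball 0 R)))
    (hw0 : ∀ᵐ x ∂(volume.restrict (ball 0 R)), 0 ≤ w x)
    (h : NegLaplacianLeDistrib (ball 0 R) w (fun x => w x ^ (p - 1))) :
    ∃ u : EuclideanSpace ℝ (Fin N) → ℝ, Measurable u ∧
      IsNonnegSubsolution R u (fun x => u x ^ (p - 1)) ∧ (∀ x, x ∉ ball 0 R → u x = 0) ∧
      u =ᵐ[volume.restrict (ball 0 R)] w := by
  set w₀ := hw.1.mk w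
  have hw₀ : Measurable w₀ := hw.1.stronglyMeasurable_mk.measurable
  set u : EuclideanSpace ℝ (Fin N) → ℝ := (ball 0 R).indicator fun x => max (w₀ x) 0 with hu
  have hum : Measurable u := (hw₀.max measurable_const).indicator measurableSet_ball
  have huw : u =ᵐ[volume.restrict (ball 0 R)] w := by
    filter_upwards [hw0, hw.1.ae_eq_mk, ae_restrict_mem measurableSet_ball] with x h1 h2 h3
    have h2 : w x = w₀ x := h2
    rw [hu, Set.indicator_of_mem h3, ← h2, max_eq_left h1]
  have hu0 : ∀ x, x ∉ ball 0 R → u x = 0 := fun x hx => Set.indicator_of_notMem hx _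
  have hunn : ∀ x, 0 ≤ u x := fun x => Set.indicator_nonneg (fun _ _ => le_max_right _ _) x
  -- This makes the source u^(p-1) vanish wherever u does, in particular outside the ball.
  have hp0 : p - 1 ≠ 0 := by linarith
  have huL := (memLp_congr_ae huw).2 hw
  have hfin : Fact (volume (ball (0 : EuclideanSpace ℝ (Fin N)) R) < ⊤) := ⟨measure_ball_lt_top⟩
  have hext : ∀ g : EuclideanSpace ℝ (Fin N) → ℝ, (∀ x, x ∉ ball 0 R → g x = 0) →
      IntegrableOn g (ball 0 R) → Integrable g := fun g hg hi =>
    (integrableOn_iff_integrable_of_support_subset fun x hx => by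
      by_contra hx'
      exact hx (hg x hx')).1 hi
  refine ⟨u, hum, ⟨?_, ?_, hunn, fun x => Real.rpow_nonneg (hunn x) _, ?_⟩, hu0, huw⟩
  · refine hext u hu0 (huL.integrable ?_)
    rw [← ENNReal.ofReal_one]
    exact ENNReal.ofReal_le_ofReal (by linarith)
  · refine hext _ (fun x hx => by simp only [hu0 x hx, Real.zero_rpow hp0]) ?_
    have := huL.integrable_norm_rpow (by simpa using by linarith) ENNReal.ofReal_ne_top
    rw [ENNReal.toReal_ofReal (by linarith)] at this
    simp only [Real.norm_of_nonneg (hunn _)] at this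
    exact this
  · intro φ h1 h2 h3 h4
    have key := h.2.2 φ h1 h2 h3 h4
    have e1 : ∫ x, u x * (Δ φ) x = ∫ x in ball 0 R, w x * (Δ φ) x := by
      rw [← setIntegral_eq_integral_of_forall_compl_eq_zero
        (s := ball (0 : EuclideanSpace ℝ (Fin N)) R) fun x hx => by rw [hu0 x hx, zero_mul]]
      refine integral_congr_ae ?_
      filter_upwards [huw] with x hx
      rw [hx]
    have e2 : ∫ x, u x ^ (p - 1) * φ x = ∫ x in ball 0 R, w x ^ (p - 1) * φ x := by
      rw [← setIntegral_eq_integral_of_forall_compl_eq_zero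
        (s := ball (0 : EuclideanSpace ℝ (Fin N)) R) fun x hx => by
          rw [hu0 x hx, Real.zero_rpow hp0, zero_mul]]
      refine integral_congr_ae ?_
      filter_upwards [huw] with x hx
      rw [hx]
    rw [e1, e2]
    exact key

theorem mainTheorem10 (N : ℕ) (hN : 1 ≤ N) (p q : ℝ) (hp : 2 ≤ p) (hq : 1 ≤ q)
    (hpq : (p - 2) / 2 * (N : ℝ) < q)
    (η ρ R : ℝ) (hη : 0 < η) (hρ : 0 < ρ) (hρR : ρ < R) :
    ∃ δ : ℝ, 0 < δ ∧
      ∀ w : EuclideanSpace ℝ (Fin N) → ℝ,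
        MemLp w (ENNReal.ofReal (p - 1)) (volume.restrict (ball 0 R)) →
        (∀ᵐ x ∂(volume.restrict (ball 0 R)), 0 ≤ w x) →
        NegLaplacianLeDistrib (ball 0 R) w (fun x => w x ^ (p - 1)) →
        ∫⁻ x in ball 0 R, ENNReal.ofReal (w x ^ q) ≤ ENNReal.ofReal δ →
        eLpNorm w ∞ (volume.restrict (ball 0 ρ)) ≤ ENNReal.ofReal η := by
  obtain ⟨δ, hδ, hmain⟩ :=
    IsNonnegSubsolution.exists_smallness N hN p q hp hq hpq η ρ R hη hρ hρR
  refine ⟨δ, hδ, fun w hw hw0 hsub hwδ => ?_⟩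
  obtain ⟨u, hum, hu, hu0, huw⟩ := exists_isNonnegSubsolution hp hw hw0 hsub
  have huδ : ∫⁻ x, ENNReal.ofReal (u x ^ q) ≤ ENNReal.ofReal δ := by
    have e : ∫⁻ x, ENNReal.ofReal (u x ^ q) = ∫⁻ x in ball 0 R, ENNReal.ofReal (u x ^ q) := by
      rw [← lintegral_indicator measurableSet_ball]
      refine lintegral_congr fun x => ?_
      by_cases hx : x ∈ ball 0 R
      · rw [Set.indicator_of_mem hx]
      · rw [Set.indicator_of_notMem hx, hu0 x hx, Real.zero_rpow (by linarith),
          ENNReal.ofReal_zero]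
    rw [e]
    refine le_trans (le_of_eq (lintegral_congr_ae ?_)) hwδ
    filter_upwards [huw] with x hx
    rw [hx]
  have hle := hmain u hum hu hu0 huδ
  rw [eLpNorm_exponent_top]
  refine eLpNormEssSup_le_of_ae_bound ?_
  have hsub : ball (0 : EuclideanSpace ℝ (Fin N)) ρ ⊆ ball 0 R := ball_subset_ball hρR.le
  filter_upwards [ae_restrict_of_ae hle, ae_restrict_of_ae_restrict_of_subset hsub huw,
    ae_restrict_mem measurableSet_ball] with x h1 h2 h3
  rw [← h2, Real.norm_of_nonneg (hu.nonneg x)]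
  exact h1 (mem_ball_zero_iff.1 h3)
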